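/- Let $d\ge 1$. For $f_0,f_1:\mathbb R^d\to\mathbb R$ and $t\in[0,1]$ put $V_t=(1-t)f_0+tf_1$, $Z_t=\int_{\mathbb R^d}e^{-V_t}\,dx$, $\rho_t=Z_t^{-1}e^{-V_t}\,dx$ and $V(t,x)=V_t(x)+\ln Z_t$. For a probability measure $\mu$ on $\mathbb R^d$ that is absolutely continuous with respect to Lebesgue measure, let $H^1_0(\mu)$ be the space of $\phi\in L_2(\mu)$ with a weak gradient $\nabla\phi\in L_2(\mu)$ and with $\int\phi\,d\mu=0$. There are a universal constant $D>0$ and positive constants $C_{1,d,\eta,R},C_{2,d,\eta,R},C_{3,d,\eta,R}$ depending only on $d,\eta,R$ such that the following holds. Let $f_0,f_1\in C^2(\mathbb R^d)$ be bounded below, and suppose that for some $\alpha,\eta,\tilde R>0$ and all $\|x\|\ge\tilde R$, $$\langle x,\nabla f_i(x)\rangle\ge\eta\|x\|,\qquad f_i(x)\ge\alpha\|x\|,\qquad i=0,1.$$ Let $R=\max\{2d/\eta,\tilde R\}$ and let $B(R)$ be the ball of radius $R$ around $0$. Then: (1) $0<Z_t<\infty$ for all $t\in[0,1]$, and $t\mapsto\rho_t$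 is a weakly continuous curve from $[0,1]$ into the absolutely continuous probability measures on $\mathbb R^d$. Consequently there is a probability measure $\boldsymbol\rho$ on $[0,1]\times\mathbb R^d$ with $\int f\,d\boldsymbol\rho=\int_0^1\int_{\mathbb R^d}f(t,x)\,d\rho_t(x)\,dt$ for all measurable $f\ge0$. (2) $G:=\|\nabla_xV\|_{L^\infty([0,1]\times B(R))}<\infty$ and $\beta:=2\|V\|_{L^\infty([0,1]\times B(R))}<\infty$. (3) There is a constant $C$ with $$0<C\le\frac{4d}{\eta^2}\Big(1+\big(C_{1,d,\eta,R}+C_{2,d,\eta,R}\,G+C_{3,d,\eta,R}\big)\,D\,R^2e^{\beta}\Big)$$ such that for every $t\in[0,1]$ and all $\phi\in H^1_0(\rho_t)$ $$\int_{\mathbb R^d}\phi^2\,d\rho_t\le C\int_{\mathbb R^d}\|\nabla\phi\|^2\,d\rho_t ,$$ and, with the same $C$, $\boldsymbol\rho$ satisfies the partial Poincaré inequality $$\int_{[0,1]\times\mathbb R^d}\phi^2\,d\boldsymbol\rho\le C\int_{[0,1]\times\mathbb R^d}\|\nabla_x\phi\|^2\,d\boldsymbol\rho$$ for all $\phi\in\mathcal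 X_0^1$. Here $\mathcal X_0^1$ is the set of $\phi\in L_2(\boldsymbol\rho)$ that have a weak spatial gradient $\nabla_x\phi\in L_2(\boldsymbol\rho)$ on $(0,1)\times\mathbb R^d$ and satisfy $\phi(t,\cdot)\in H^1_0(\rho_t)$ for almost every $t\in[0,1]$. -/

import Mathlib

open MeasureTheory Set
open scoped ContDiff

noncomputable section

namespace PPI

/-- Euclidean space `ℝ^d`. -/
abbrev E (d : ℕ) : Type := EuclideanSpace ℝ (Fin d)

/-! ### Weak derivatives -/

/-- `g` is the weak derivative (with respect to Lebesgue measure) of `f` in the direction `v`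
on the open set `Ω`, tested against `C_c^∞(Ω)`. -/
def HasWeakDerivOn {F : Type*} [NormedAddCommGroup F] [NormedSpace ℝ F] [MeasureSpace F]
    (Ω : Set F) (v : F) (f g : F → ℝ) : Prop :=
  LocallyIntegrableOn f Ω volume ∧ LocallyIntegrableOn g Ω volume ∧
    ∀ ψ : F → ℝ, ContDiff ℝ ∞ ψ → HasCompactSupport ψ → tsupport ψ ⊆ Ω →
      ∫ z in Ω, f z * fderiv ℝ ψ z v = - ∫ z in Ω, g z * ψ z

/-- `G` is the weak gradient of `f` on `ℝ^d`. -/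
def HasWeakGradient {d : ℕ} (f : E d → ℝ) (G : E d → E d) : Prop :=
  ∀ i : Fin d, HasWeakDerivOn univ (EuclideanSpace.single i (1 : ℝ)) f (fun x => G x i)

/-- `G` is the weak spatial gradient `∇ₓ s` of `s = s(t, x)` on `(0,1) × ℝ^d`. -/
def HasWeakSpatialGradient {d : ℕ} (s : ℝ × E d → ℝ) (G : ℝ × E d → E d) : Prop :=
  ∀ i : Fin d, HasWeakDerivOn (Ioo (0 : ℝ) 1 ×ˢ univ)
    ((0 : ℝ), (EuclideanSpace.single i (1 : ℝ) : E d)) s (fun p => G p i)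

/-! ### Curves of measures and the associated space-time measure -/

/-- `t ↦ μ t` restricts to a weakly continuous curve from `[0,1]` into the probability measures
on `ℝ^d` that are absolutely continuous with respect to Lebesgue measure. -/
def IsWeaklyContinuousCurve {d : ℕ} (μ : ℝ → Measure (E d)) : Prop :=
  (∀ t ∈ Icc (0 : ℝ) 1, μ t ≪ volume) ∧
    ∃ ν : Icc (0 : ℝ) 1 → ProbabilityMeasure (E d),
      (∀ t, (ν t : Measure (E d)) = μ t) ∧ Continuous ν

/-- The space-time measure `∫₀¹ δ_t ⊗ μ_t dt`, carried by `[0,1] × ℝ^d`. -/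
def spaceTime {d : ℕ} (μ : ℝ → Measure (E d)) : Measure (ℝ × E d) :=
  (volume.restrict (Icc (0 : ℝ) 1)).bind (fun t => (μ t).map (Prod.mk t))

/-- The formula characterising the space-time measure `π` of the curve `μ`:
`∫ f dπ = ∫₀¹ ∫ f(t, x) dμ_t(x) dt`. -/
def IsDisintegration {d : ℕ} (μ : ℝ → Measure (E d)) (π : Measure (ℝ × E d)) : Prop :=
  ∀ f : ℝ × E d → ENNReal, Measurable f →
    ∫⁻ p, f p ∂π = ∫⁻ t in Icc (0 : ℝ) 1, ∫⁻ x, f (t, x) ∂(μ t)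

/-! ### Weighted Sobolev spaces -/

/-- `f ∈ H¹(μ)`: `f ∈ L²(μ)` has a weak gradient in `L²(μ)`. -/
def MemH1 {d : ℕ} (μ : Measure (E d)) (f : E d → ℝ) : Prop :=
  MemLp f 2 μ ∧ ∃ G : E d → E d, HasWeakGradient f G ∧ MemLp G 2 μ

/-- `f ∈ H¹₀(μ)`: `f ∈ H¹(μ)` has zero mean. -/
def MemH10 {d : ℕ} (μ : Measure (E d)) (f : E d → ℝ) : Prop :=
  MemH1 μ f ∧ ∫ x, f x ∂μ = 0

/-- `s ∈ H¹ₓ(π)`: `s ∈ L²(π)` has a weak spatial gradient in `L²(π)`. -/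
def MemHx1 {d : ℕ} (π : Measure (ℝ × E d)) (s : ℝ × E d → ℝ) : Prop :=
  MemLp s 2 π ∧ ∃ G : ℝ × E d → E d, HasWeakSpatialGradient s G ∧ MemLp G 2 π

/-- `s ∈ 𝒳¹₀`: `s ∈ H¹ₓ` of the space-time measure and `s(t, ·) ∈ H¹₀(μ_t)` for a.e. `t`. -/
def MemX01 {d : ℕ} (μ : ℝ → Measure (E d)) (s : ℝ × E d → ℝ) : Prop :=
  MemHx1 (spaceTime μ) s ∧
    ∀ᵐ t ∂(volume.restrict (Icc (0 : ℝ) 1)), MemH10 (μ t) (fun x => s (t, x))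

/-! ### Poincaré inequalities
Weak gradients are unique up to null sets, so quantifying over all of them is harmless. -/

/-- The Poincaré inequality for `μ` on `H¹₀(μ)` with constant `K`. -/
def PoincareWith {d : ℕ} (μ : Measure (E d)) (K : ℝ) : Prop :=
  ∀ f : E d → ℝ, MemH10 μ f → ∀ G : E d → E d, HasWeakGradient f G →
    ∫ x, f x ^ 2 ∂μ ≤ K * ∫ x, ‖G x‖ ^ 2 ∂μ

/-- The partial Poincaré inequality for the space-time measure of `μ` with constant `K`. -/
def PartialPoincareWith {d : ℕ} (μ : ℝ → Measure (E d)) (K : ℝ) : Prop :=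
  ∀ s : ℝ × E d → ℝ, MemX01 μ s → ∀ G : ℝ × E d → E d, HasWeakSpatialGradient s G →
    ∫ p, s p ^ 2 ∂(spaceTime μ) ≤ K * ∫ p, ‖G p‖ ^ 2 ∂(spaceTime μ)

/-! ### The linear interpolation -/

/-- `V_t = (1 - t) f₀ + t f₁`. -/
def potential {d : ℕ} (f₀ f₁ : E d → ℝ) (t : ℝ) (x : E d) : ℝ :=
  (1 - t) * f₀ x + t * f₁ x

/-- `Z_t = ∫ e^{-V_t} dx`. -/
def partition {d : ℕ} (f₀ f₁ : E d → ℝ) (t : ℝ) : ℝ :=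
  ∫ x, Real.exp (- potential f₀ f₁ t x)

/-- The measure `ρ_t` with Lebesgue density `Z_t⁻¹ e^{-V_t}`. -/
def linearCurve {d : ℕ} (f₀ f₁ : E d → ℝ) (t : ℝ) : Measure (E d) :=
  volume.withDensity fun x =>
    ENNReal.ofReal ((partition f₀ f₁ t)⁻¹ * Real.exp (- potential f₀ f₁ t x))

/-- The normalized potential `V(t, x) = V_t(x) + log Z_t`, so that `ρ_t = e^{-V(t, ·)} dx`. -/
def normPotential {d : ℕ} (f₀ f₁ : E d → ℝ) (t : ℝ) (x : E d) : ℝ :=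
  potential f₀ f₁ t x + Real.log (partition f₀ f₁ t)

/-- The values of `|V|` on `[0,1] × B(R)`. -/
def potentialValues {d : ℕ} (f₀ f₁ : E d → ℝ) (R : ℝ) : Set ℝ :=
  (fun p : ℝ × E d => |normPotential f₀ f₁ p.1 p.2|) ''
    (Icc (0 : ℝ) 1 ×ˢ Metric.closedBall (0 : E d) R)

/-- The values of `‖∇ₓ V‖` on `[0,1] × B(R)`. -/
def gradientValues {d : ℕ} (f₀ f₁ : E d → ℝ) (R : ℝ) : Set ℝ :=
  (fun p : ℝ × E d => ‖gradient (normPotential f₀ f₁ p.1) p.2‖) ''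
    (Icc (0 : ℝ) 1 ×ˢ Metric.closedBall (0 : E d) R)

/-- Drift and linear growth conditions outside the open ball of radius `R₀`. -/
def DriftGrowth {d : ℕ} (f : E d → ℝ) (α η R₀ : ℝ) : Prop :=
  ∀ x : E d, R₀ ≤ ‖x‖ → η * ‖x‖ ≤ inner ℝ x (gradient f x) ∧ α * ‖x‖ ≤ f x

end PPI

end

/-! Fix `t` and write `ρ_t = e^{-V} dx`. The drift condition passes to convex combinations, and `ln
Z_t` does not affect the gradient, so `⟨x, ∇V⟩ ≥ η‖x‖` holds off `B(R)` for every `t`. It therefore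
suffices to prove a Poincaré inequality for `e^{-V} dx` whose constant depends only on `d`, `η`, `R`
and on bounds `M` for `|V|` and `g` for `‖∇V‖` over `B(R)`: the suprema over `[0,1] × B(R)` serve
all times at once.

The fixed-time inequality (`poincareWith_gibbs`) is a Lyapunov argument with the function `exp(γ√(R²
+ ‖x‖²))`, `γ = η/8`, written as one integration by parts. Put `s = √(R² + ‖x‖²)`. Integrating `f²`
against the divergence of `γ e^{-V} x / s` and applying Young's inequality to the cross term gives
`∫ q f² e^{-V} ≤ ∫ ‖∇f‖² e^{-V}`. The weight `q` is at least `η²/64` off the ball and bounded below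
on it, so `∫ f² e^{-V}` is controlled by the energy and by the mass of `f²` on the ball
(`lyapunov_inequality`).

This is applied to `f` minus its Lebesgue mean over the ball. The mass on the ball is then bounded
by the Poincaré inequality for Lebesgue measure there (`ball_poincare`), proved by integrating the
gradient along segments. Passing from `e^{-V} dx` to `dx` and back costs `e^M` twice, which is the
factor `e^β`. Subtracting a constant other than the `ρ_t`-mean is harmless, because the variance is
the least value of `∫ (f - c)² dρ_t`.

Weak gradients are reached by mollification, which converges locally in `L²`. The partial inequality
is the fixed-time one integrated over `t`; what has to be shown is that almost every slice of `∇ₓφ`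
is the weak gradient of the slice of `φ` (`HasWeakSpatialGradient.ae_slice_eq`). The bound `e^{-V_t}
≤ e^{m - α‖x‖}`, uniform in `t`, gives finiteness of `Z_t` and weak continuity by domination;
finiteness of the suprema is compactness. -/

noncomputable section

namespace PPI

open Filter Topology
open scoped Convolution

variable {d : ℕ}

/-! ### Mollification -/

/-- A sequence of bump functions shrinking to the origin. -/
def bump (d k : ℕ) : ContDiffBump (0 : E d) where
  rIn := 1 / (2 * ((k : ℝ) + 1))
  rOut := 1 / ((k : ℝ) + 1)
  rIn_pos := by positivity
  rIn_lt_rOut := by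
    have : (0 : ℝ) < (k : ℝ) + 1 := by positivity
    exact one_div_lt_one_div_of_lt this (by linarith)

/-- The mollifying kernels. -/
def mollifier (d k : ℕ) : E d → ℝ := (bump d k).normed volume

/-- The mollification of `g`. -/
def mollify {d : ℕ} (k : ℕ) (g : E d → ℝ) (x : E d) : ℝ :=
  ∫ t, mollifier d k (x - t) * g t

lemma contDiff_mollifier (k : ℕ) : ContDiff ℝ ∞ (mollifier d k) :=
  (bump d k).contDiff_normed

lemma hasCompactSupport_mollifier (k : ℕ) : HasCompactSupport (mollifier d k) :=
  (bump d k).hasCompactSupport_normed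

lemma mollifier_nonneg (k : ℕ) (x : E d) : 0 ≤ mollifier d k x :=
  (bump d k).nonneg_normed x

lemma integral_mollifier (k : ℕ) : ∫ x, mollifier d k x = 1 :=
  (bump d k).integral_normed

lemma mollifier_eq_zero (k : ℕ) {x : E d} (hx : 1 ≤ ‖x‖) : mollifier d k x = 0 := by
  by_contra h
  have h1 : x ∈ Function.support (mollifier d k) := h
  rw [mollifier, ContDiffBump.support_normed_eq, mem_ball_zero_iff] at h1
  have h2 : (bump d k).rOut ≤ 1 := by
    change 1 / ((k : ℝ) + 1) ≤ 1
    rw [div_le_one (by positivity)]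
    linarith [Nat.cast_nonneg (α := ℝ) k]
  linarith

lemma mollify_eq_convolution (k : ℕ) (g : E d → ℝ) :
    mollify k g = (mollifier d k ⋆[ContinuousLinearMap.lsmul ℝ ℝ, volume] g) := by
  ext x
  rw [convolution_eq_swap]
  rfl

lemma mollify_eq_convolution' (k : ℕ) (g : E d → ℝ) :
    mollify k g = (g ⋆[ContinuousLinearMap.mul ℝ ℝ, volume] mollifier d k) := by
  ext x
  rw [convolution_def]
  exact integral_congr_ae (Eventually.of_forall fun t => mul_comm _ _)

lemma contDiff_mollify (k : ℕ) {g : E d → ℝ} (hg : LocallyIntegrable g volume) :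
    ContDiff ℝ ∞ (mollify k g) := by
  rw [mollify_eq_convolution]
  exact (hasCompactSupport_mollifier k).contDiff_convolution_left _ (contDiff_mollifier k) hg

lemma contDiff_mollifier_sub (k : ℕ) (x : E d) :
    ContDiff ℝ ∞ (fun t => mollifier d k (x - t)) :=
  (contDiff_mollifier k).comp (contDiff_const.sub contDiff_id)

lemma hasCompactSupport_mollifier_sub (k : ℕ) (x : E d) :
    HasCompactSupport (fun t => mollifier d k (x - t)) :=
  (hasCompactSupport_mollifier k).comp_homeomorph (Homeomorph.subLeft x)

/-- The derivative may be put on the kernel, and `t ↦ mollifier d k (x - t)` is an admissible test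
function; the sign from the reflection cancels the one in the weak derivative. -/
lemma fderiv_mollify (k : ℕ) {f g : E d → ℝ} {v : E d} (h : HasWeakDerivOn univ v f g) (x : E d) :
    fderiv ℝ (mollify k f) x v = mollify k g x := by
  have hf : LocallyIntegrable f volume := locallyIntegrableOn_univ.1 h.1
  have h1 := (hasCompactSupport_mollifier (d := d) k).hasFDerivAt_convolution_right
    (ContinuousLinearMap.mul ℝ ℝ) hf ((contDiff_mollifier k).of_le (by exact_mod_cast le_top)) x
  rw [← mollify_eq_convolution'] at h1
  rw [h1.fderiv, convolution_precompR_apply _ hf ((hasCompactSupport_mollifier k).fderiv ℝ)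
    ((contDiff_mollifier k).continuous_fderiv (by simp)), convolution_def]
  have h2 := h.2.2 _ (contDiff_mollifier_sub k x) (hasCompactSupport_mollifier_sub k x)
    (subset_univ _)
  simp only [Measure.restrict_univ] at h2
  have h3 : ∀ t, fderiv ℝ (fun t => mollifier d k (x - t)) t v
      = - fderiv ℝ (mollifier d k) (x - t) v := by
    intro t
    have hd : HasFDerivAt (mollifier d k) (fderiv ℝ (mollifier d k) (x - t)) (x - t) :=
      ((contDiff_mollifier k).differentiable (by simp) _).hasFDerivAt
    have h4 := hd.comp t ((hasFDerivAt_id t).const_sub x)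
    have h5 := h4.fderiv
    simp only [Function.comp_def] at h5
    rw [h5]
    simp
  simp only [h3, mul_neg, integral_neg, neg_inj] at h2
  simp only [ContinuousLinearMap.mul_apply', h2, mollify]
  exact integral_congr_ae (Eventually.of_forall fun t => mul_comm _ _)

lemma ae_tendsto_mollify {g : E d → ℝ} (hg : LocallyIntegrable g volume) :
    ∀ᵐ x, Tendsto (fun k => mollify k g x) atTop (𝓝 (g x)) := by
  simp only [mollify_eq_convolution]
  refine ContDiffBump.ae_convolution_tendsto_right_of_locallyIntegrable (φ := bump d) (K := 2)
    tendsto_one_div_add_atTop_nhds_zero_nat (Eventually.of_forall fun k => ?_) hg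
  -- The ratio of outer to inner radius is exactly 2, so the kernels are dominated by averages over
  -- balls and Lebesgue differentiation applies.
  change 1 / ((k : ℝ) + 1) ≤ 2 * (1 / (2 * ((k : ℝ) + 1)))
  apply le_of_eq
  field_simp

/-- The probability measure with density `mollifier d k`. -/
def mollifierMeasure (d k : ℕ) : Measure (E d) :=
  volume.withDensity fun x => ENNReal.ofReal (mollifier d k x)

instance (k : ℕ) : IsProbabilityMeasure (mollifierMeasure d k) := by
  constructor
  rw [mollifierMeasure, withDensity_apply _ MeasurableSet.univ, Measure.restrict_univ,
    ← ofReal_integral_eq_lintegral_ofReal, integral_mollifier, ENNReal.ofReal_one]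
  · exact (contDiff_mollifier k).continuous.integrable_of_hasCompactSupport
      (hasCompactSupport_mollifier k)
  · exact Eventually.of_forall (mollifier_nonneg k)

lemma mollify_eq_integral (k : ℕ) (g : E d → ℝ) (x : E d) :
    mollify k g x = ∫ t, g (x - t) ∂(mollifierMeasure d k) := by
  rw [mollify_eq_convolution, convolution_def, mollifierMeasure,
    integral_withDensity_eq_integral_toReal_smul
      (contDiff_mollifier k).continuous.measurable.ennreal_ofReal
      (Eventually.of_forall fun _ => ENNReal.ofReal_lt_top)]
  refine integral_congr_ae (Eventually.of_forall fun t => ?_)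
  simp [ENNReal.toReal_ofReal (mollifier_nonneg k t)]

lemma eLpNorm_two_sq {α F : Type*} [MeasurableSpace α] [NormedAddCommGroup F] (μ : Measure α)
    (g : α → F) : eLpNorm g 2 μ ^ 2 = ∫⁻ t, ‖g t‖ₑ ^ 2 ∂μ := by
  have := eLpNorm_nnreal_pow_eq_lintegral (μ := μ) (f := g) (p := 2) (by norm_num)
  simpa using this

lemma enorm_sq_integral_le {α : Type*} [MeasurableSpace α] (ν : Measure α) [IsProbabilityMeasure ν]
    {g : α → ℝ} (hg : AEMeasurable g ν) :
    ‖∫ t, g t ∂ν‖ₑ ^ 2 ≤ ∫⁻ t, ‖g t‖ₑ ^ 2 ∂ν := by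
  have h1 : ‖∫ t, g t ∂ν‖ₑ ≤ eLpNorm g 1 ν := by
    rw [eLpNorm_one_eq_lintegral_enorm]
    exact enorm_integral_le_lintegral_enorm _
  have h2 : eLpNorm g 1 ν ≤ eLpNorm g 2 ν :=
    eLpNorm_le_eLpNorm_of_exponent_le (by norm_num) hg.aestronglyMeasurable
  rw [← eLpNorm_two_sq]
  gcongr
  exact h1.trans h2

/-- Jensen for the probability measure `mollifierMeasure`, then Tonelli and translation invariance.
-/
lemma lintegral_mollify_sq_le (k : ℕ) {g : E d → ℝ} (hg : Measurable g) :
    ∫⁻ x, ‖mollify k g x‖ₑ ^ 2 ≤ ∫⁻ x, ‖g x‖ₑ ^ 2 := by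
  calc ∫⁻ x, ‖mollify k g x‖ₑ ^ 2
      ≤ ∫⁻ x, ∫⁻ t, ‖g (x - t)‖ₑ ^ 2 ∂(mollifierMeasure d k) := by
        refine lintegral_mono fun x => ?_
        rw [mollify_eq_integral]
        exact enorm_sq_integral_le _ (by fun_prop)
    _ = ∫⁻ t, (∫⁻ x, ‖g (x - t)‖ₑ ^ 2) ∂(mollifierMeasure d k) := by
        have hm : Measurable (Function.uncurry fun x t : E d => ‖g (x - t)‖ₑ ^ 2) :=
          (hg.comp (measurable_fst.sub measurable_snd)).enorm.pow_const 2
        exact lintegral_lintegral_swap hm.aemeasurable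
    _ = ∫⁻ x, ‖g x‖ₑ ^ 2 := by
        have hs : ∀ t : E d, ∫⁻ x, ‖g (x - t)‖ₑ ^ 2 = ∫⁻ x, ‖g x‖ₑ ^ 2 := fun t =>
          lintegral_sub_right_eq_self (fun x => ‖g x‖ₑ ^ 2) t
        simp [hs]

/-- Fatou: almost everywhere convergence without gain of `L²`-mass is `L²`-convergence. -/
lemma tendsto_lintegral_sub_sq {α : Type*} [MeasurableSpace α] {μ : Measure α}
    {f : ℕ → α → ℝ} {g : α → ℝ} (hf : ∀ k, Measurable (f k)) (hg : Measurable g)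
    (hfin : ∫⁻ x, ‖g x‖ₑ ^ 2 ∂μ ≠ ⊤) (hle : ∀ k, ∫⁻ x, ‖f k x‖ₑ ^ 2 ∂μ ≤ ∫⁻ x, ‖g x‖ₑ ^ 2 ∂μ)
    (hae : ∀ᵐ x ∂μ, Tendsto (fun k => f k x) atTop (𝓝 (g x))) :
    Tendsto (fun k => ∫⁻ x, ‖f k x - g x‖ₑ ^ 2 ∂μ) atTop (𝓝 0) := by
  set A := ∫⁻ x, ‖g x‖ₑ ^ 2 ∂μ with hA
  have hsq : ∀ r : ℝ, ‖r‖ₑ ^ 2 = ENNReal.ofReal (r ^ 2) := by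
    intro r
    rw [Real.enorm_eq_ofReal_abs, ← ENNReal.ofReal_pow (abs_nonneg r), sq_abs]
  -- Parallelogram identity: `|f_k - g|² = 2|f_k|² + 2|g|² - |f_k + g|²`. Fatou is applied to the
  -- last term, whose limit `4|g|²` exhausts the bound `4A` on the rest.
  let h : ℕ → α → ENNReal := fun k x => ENNReal.ofReal ((f k x + g x) ^ 2)
  have hadd : ∀ k x, h k x + ‖f k x - g x‖ₑ ^ 2 = 2 * ‖f k x‖ₑ ^ 2 + 2 * ‖g x‖ₑ ^ 2 := by
    intro k x
    simp only [hsq, h]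
    rw [show (2 : ENNReal) = ENNReal.ofReal 2 by simp, ← ENNReal.ofReal_mul (by norm_num),
      ← ENNReal.ofReal_mul (by norm_num), ← ENNReal.ofReal_add (by positivity) (by positivity),
      ← ENNReal.ofReal_add (by positivity) (by positivity)]
    congr 1
    ring
  have hint : ∀ k, ∫⁻ x, h k x ∂μ + ∫⁻ x, ‖f k x - g x‖ₑ ^ 2 ∂μ ≤ 4 * A := by
    intro k
    have hf' := hf k
    rw [← lintegral_add_left (by fun_prop), lintegral_congr (hadd k),
      lintegral_add_left (by fun_prop), lintegral_const_mul _ (by fun_prop),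
      lintegral_const_mul _ (by fun_prop)]
    calc _ ≤ 2 * A + 2 * A := by gcongr; exact hle k
      _ = 4 * A := by rw [← add_mul]; norm_num
  have hlim : 4 * A ≤ liminf (fun k => ∫⁻ x, h k x ∂μ) atTop := by
    calc 4 * A = ∫⁻ x, liminf (fun k => h k x) atTop ∂μ := by
          rw [hA, ← lintegral_const_mul _ (by fun_prop)]
          refine lintegral_congr_ae ?_
          filter_upwards [hae] with x hx
          have : Tendsto (fun k => h k x) atTop (𝓝 (ENNReal.ofReal ((g x + g x) ^ 2))) :=
            ENNReal.tendsto_ofReal ((hx.add_const _).pow 2)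
          rw [this.liminf_eq, hsq, show (4 : ENNReal) = ENNReal.ofReal 4 by simp,
            ← ENNReal.ofReal_mul (by norm_num)]
          congr 1
          ring
      _ ≤ _ := lintegral_liminf_le' fun k => by have := hf k; fun_prop
  rw [ENNReal.tendsto_nhds_zero]
  intro ε hε
  rcases eq_or_ne A 0 with h0 | h0
  · refine Eventually.of_forall fun k => ?_
    have := hint k
    rw [h0, mul_zero] at this
    exact (le_add_self.trans this).trans hε.le
  have hA4 : 4 * A ≠ ⊤ := ENNReal.mul_ne_top (by norm_num) hfin
  have hA0 : 4 * A ≠ 0 := mul_ne_zero (by norm_num) h0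
  have hlt : 4 * A - ε < liminf (fun k => ∫⁻ x, h k x ∂μ) atTop :=
    (ENNReal.sub_lt_self hA4 hA0 hε.ne').trans_le hlim
  filter_upwards [eventually_lt_of_lt_liminf hlt] with k hk
  have h1 := hint k
  have hne : ∫⁻ x, h k x ∂μ ≠ ⊤ := ne_top_of_le_ne_top hA4 (le_self_add.trans h1)
  have h2 : 4 * A ≤ ∫⁻ x, h k x ∂μ + ε := tsub_le_iff_right.1 hk.le
  exact (ENNReal.add_le_add_iff_left hne).1 (h1.trans h2)

lemma mollify_congr_ae (k : ℕ) {g g' : E d → ℝ} (h : g =ᵐ[volume] g') :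
    mollify k g = mollify k g' := by
  ext x
  refine integral_congr_ae ?_
  filter_upwards [h] with t ht
  rw [ht]

lemma tendsto_eLpNorm_mollify_sub {g : E d → ℝ} (hg : MemLp g 2 volume) :
    Tendsto (fun k => eLpNorm (mollify k g - g) 2 volume) atTop (𝓝 0) := by
  obtain ⟨g', hg'm, hgg'⟩ := hg.1
  have hg' : MemLp g' 2 volume := hg.ae_eq hgg'
  have hloc : LocallyIntegrable g' volume := hg'.locallyIntegrable (by norm_num)
  have hfin : ∫⁻ x, ‖g' x‖ₑ ^ 2 ≠ ⊤ := by
    rw [← eLpNorm_two_sq]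
    exact ENNReal.pow_ne_top hg'.2.ne
  have h1 := tendsto_lintegral_sub_sq (fun k => (contDiff_mollify k hloc).continuous.measurable)
    hg'm.measurable hfin (fun k => lintegral_mollify_sq_le k hg'm.measurable)
    (ae_tendsto_mollify hloc)
  have h2 : ∀ k, eLpNorm (mollify k g - g) 2 volume
      = (∫⁻ x, ‖mollify k g' x - g' x‖ₑ ^ 2) ^ (1 / 2 : ℝ) := by
    intro k
    rw [eLpNorm_congr_ae ((ae_eq_refl _).sub hgg'), mollify_congr_ae k hgg',
      eLpNorm_eq_lintegral_rpow_enorm_toReal (by norm_num) (by norm_num)]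
    simp
  simp only [h2]
  have := (ENNReal.continuous_rpow_const (y := (1 / 2 : ℝ))).tendsto 0
  simp only [ENNReal.zero_rpow_of_pos (show (0 : ℝ) < 1 / 2 by norm_num)] at this
  exact this.comp h1

/-! ### Local square integrability and local convergence of mollifications. -/

/-- `f` is locally square integrable. -/
def LocL2 (f : E d → ℝ) : Prop :=
  ∀ r : ℝ, MemLp f 2 (volume.restrict (Metric.closedBall 0 r))

instance (R : ℝ) : IsFiniteMeasure (volume.restrict (Metric.closedBall (0 : E d) R)) :=
  ⟨by simpa using measure_closedBall_lt_top⟩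

lemma memLp_restrict_of_continuous {F : Type*} [NormedAddCommGroup F] {f : E d → F}
    (hf : Continuous f) (R : ℝ) : MemLp f 2 (volume.restrict (Metric.closedBall (0 : E d) R)) := by
  obtain ⟨C, hC⟩ := (isCompact_closedBall (0 : E d) R).exists_bound_of_continuousOn hf.continuousOn
  refine MemLp.of_bound hf.aestronglyMeasurable C ?_
  filter_upwards [ae_restrict_mem measurableSet_closedBall] with x hx using hC x hx

lemma locL2_of_continuous {f : E d → ℝ} (hf : Continuous f) : LocL2 f :=
  memLp_restrict_of_continuous hf

lemma locL2_mollify {f : E d → ℝ} (hf : LocallyIntegrable f volume) (k : ℕ) :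
    LocL2 (mollify k f) :=
  locL2_of_continuous (contDiff_mollify k hf).continuous

/-- The kernels vanish at distance 1, so on the ball of radius `r` only the values of `g` within
radius `r + 1` matter, and `g` may be truncated to a global `L²` function. -/
lemma tendsto_eLpNorm_mollify_restrict {g : E d → ℝ} (hg : LocL2 g) (r : ℝ) :
    Tendsto (fun k => eLpNorm (mollify k g - g) 2 (volume.restrict (Metric.closedBall 0 r)))
      atTop (𝓝 0) := by
  set h := (Metric.closedBall (0 : E d) (r + 1)).indicator g with hh
  have hm : MemLp h 2 volume := (memLp_indicator_iff_restrict measurableSet_closedBall).2 (hg _)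
  have h1 := tendsto_eLpNorm_mollify_sub hm
  refine tendsto_of_tendsto_of_tendsto_of_le_of_le tendsto_const_nhds h1 (fun _ => zero_le)
    fun k => ?_
  calc _ = eLpNorm (mollify k h - h) 2 (volume.restrict (Metric.closedBall 0 r)) := by
        refine eLpNorm_congr_ae ?_
        filter_upwards [ae_restrict_mem measurableSet_closedBall] with x hx
        have hx' : ‖x‖ ≤ r := by simpa using hx
        have e1 : h x = g x := indicator_of_mem (by simp; linarith) _
        have e2 : PPI.mollify k h x = PPI.mollify k g x := by
          refine integral_congr_ae (Eventually.of_forall fun t => ?_)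
          by_cases ht : t ∈ Metric.closedBall (0 : E d) (r + 1)
          · simp only [hh, indicator_of_mem ht]
          · have : 1 ≤ ‖x - t‖ := by
              have h3 : r + 1 < ‖t‖ := by simpa using ht
              have h4 := norm_sub_norm_le t x
              rw [norm_sub_rev] at h4
              linarith
            simp [mollifier_eq_zero k this]
        simp [e1, e2]
    _ ≤ _ := eLpNorm_mono_measure _ Measure.restrict_le_self

/-! ### The chain rule for squares -/

lemma tendsto_integral_mul_of_tendsto_eLpNorm {α : Type*} [MeasurableSpace α] {μ : Measure α}
    {F G : ℕ → α → ℝ} {f g : α → ℝ} (hF : ∀ k, MemLp (F k) 2 μ) (hG : ∀ k, MemLp (G k) 2 μ)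
    (hf : MemLp f 2 μ) (hg : MemLp g 2 μ)
    (hFf : Tendsto (fun k => eLpNorm (F k - f) 2 μ) atTop (𝓝 0))
    (hGg : Tendsto (fun k => eLpNorm (G k - g) 2 μ) atTop (𝓝 0)) :
    Tendsto (fun k => ∫ x, F k x * G k x ∂μ) atTop (𝓝 (∫ x, f x * g x ∂μ)) := by
  have h1 := (Lp.tendsto_Lp_iff_tendsto_eLpNorm'' F hF f hf).2 hFf
  have h2 := (Lp.tendsto_Lp_iff_tendsto_eLpNorm'' G hG g hg).2 hGg
  have h3 := h1.inner (𝕜 := ℝ) h2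
  have key : ∀ {a b : α → ℝ} (ha : MemLp a 2 μ) (hb : MemLp b 2 μ),
      inner ℝ (ha.toLp a) (hb.toLp b) = ∫ x, a x * b x ∂μ := by
    intro a b ha hb
    rw [L2.inner_def]
    refine integral_congr_ae ?_
    filter_upwards [ha.coeFn_toLp, hb.coeFn_toLp] with x h1 h2
    rw [h1, h2]
    simp [mul_comm]
  simpa only [key] using h3

lemma tendsto_integral_mul_mul_of_tendsto_eLpNorm {α : Type*} [MeasurableSpace α] {μ : Measure α}
    {F G : ℕ → α → ℝ} {f g w : α → ℝ} (hF : ∀ k, MemLp (F k) 2 μ) (hG : ∀ k, MemLp (G k) 2 μ)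
    (hf : MemLp f 2 μ) (hg : MemLp g 2 μ)
    (hFf : Tendsto (fun k => eLpNorm (F k - f) 2 μ) atTop (𝓝 0))
    (hGg : Tendsto (fun k => eLpNorm (G k - g) 2 μ) atTop (𝓝 0))
    (hw : AEStronglyMeasurable w μ) {M : ℝ} (hM : ∀ x, ‖w x‖ ≤ M) :
    Tendsto (fun k => ∫ x, F k x * G k x * w x ∂μ) atTop (𝓝 (∫ x, f x * g x * w x ∂μ)) := by
  have hmul : ∀ {a : α → ℝ}, MemLp a 2 μ → MemLp (fun x => a x * w x) 2 μ := by
    intro a ha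
    refine ha.of_le_mul (c := M) (ha.1.mul hw) (Eventually.of_forall fun x => ?_)
    rw [norm_mul, mul_comm]
    exact mul_le_mul_of_nonneg_right (hM x) (norm_nonneg _)
  have h := tendsto_integral_mul_of_tendsto_eLpNorm hF (fun k => hmul (hG k)) hf (hmul hg) hFf ?_
  · simpa only [mul_assoc] using h
  · have h1 : ∀ k, eLpNorm ((fun x => G k x * w x) - fun x => g x * w x) 2 μ
        ≤ ENNReal.ofReal M * eLpNorm (G k - g) 2 μ := by
      intro k
      refine eLpNorm_le_mul_eLpNorm_of_ae_le_mul (Eventually.of_forall fun x => ?_) 2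
      simp only [Pi.sub_apply, ← sub_mul]
      rw [norm_mul, mul_comm]
      exact mul_le_mul_of_nonneg_right (hM x) (norm_nonneg _)
    have h2 := ENNReal.Tendsto.const_mul (a := ENNReal.ofReal M) hGg (Or.inr ENNReal.ofReal_ne_top)
    rw [mul_zero] at h2
    exact tendsto_of_tendsto_of_tendsto_of_le_of_le tendsto_const_nhds h2 (fun _ => zero_le) h1

lemma exists_tsupport_subset_closedBall {w : E d → ℝ} (hw : HasCompactSupport w) :
    ∃ r : ℝ, ∀ x ∉ Metric.closedBall (0 : E d) r, w x = 0 := by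
  obtain ⟨r, hr⟩ := hw.isCompact.isBounded.subset_closedBall (0 : E d)
  exact ⟨r, fun x hx => image_eq_zero_of_notMem_tsupport fun h => hx (hr h)⟩

lemma LocL2.integrable_mul_mul {f g w : E d → ℝ} (hf : LocL2 f) (hg : LocL2 g)
    (hw : Continuous w) (hc : HasCompactSupport w) :
    Integrable (fun x => f x * g x * w x) volume := by
  obtain ⟨r, hr⟩ := exists_tsupport_subset_closedBall hc
  obtain ⟨M, hM⟩ := hc.exists_bound_of_continuous hw
  have h1 : IntegrableOn (fun x => f x * g x * w x) (Metric.closedBall 0 r) volume :=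
    ((hf r).integrable_mul (hg r)).mul_bdd (c := M) hw.aestronglyMeasurable
      (Eventually.of_forall hM)
  refine (integrableOn_iff_integrable_of_support_subset fun x hx => ?_).1 h1
  by_contra h
  exact hx (by simp [hr x h])

/-- The weak form of `∂ᵥ(f²) = 2 f ∂ᵥf`. It is classical for mollifications, and both sides are
integrals of products of two `L²`-convergent sequences against a bounded weight. -/
lemma integral_sq_mul_fderiv {f g : E d → ℝ} {v : E d} (h : HasWeakDerivOn univ v f g)
    (hf : LocL2 f) (hg : LocL2 g) {w : E d → ℝ} (hw : ContDiff ℝ 1 w) (hc : HasCompactSupport w) :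
    ∫ x, f x * f x * fderiv ℝ w x v = - (2 * ∫ x, f x * g x * w x) := by
  have hfl : LocallyIntegrable f volume := locallyIntegrableOn_univ.1 h.1
  have hgl : LocallyIntegrable g volume := locallyIntegrableOn_univ.1 h.2.1
  have hw'c : Continuous fun x => fderiv ℝ w x v :=
    (hw.continuous_fderiv (by simp)).clm_apply continuous_const
  have hc' : HasCompactSupport fun x => fderiv ℝ w x v := hc.fderiv_apply ℝ v
  have hlim : ∀ {a b u : E d → ℝ}, LocallyIntegrable a volume → LocallyIntegrable b volume →
      LocL2 a → LocL2 b → Continuous u → HasCompactSupport u →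
      Tendsto (fun k => ∫ x, mollify k a x * mollify k b x * u x) atTop
        (𝓝 (∫ x, a x * b x * u x)) := by
    intro a b u hal hbl ha hb hu huc
    obtain ⟨r, hr⟩ := exists_tsupport_subset_closedBall huc
    obtain ⟨M, hM⟩ := huc.exists_bound_of_continuous hu
    have h1 := tendsto_integral_mul_mul_of_tendsto_eLpNorm
      (fun k => locL2_mollify hal k r) (fun k => locL2_mollify hbl k r) (ha r) (hb r)
      (tendsto_eLpNorm_mollify_restrict ha r) (tendsto_eLpNorm_mollify_restrict hb r)
      hu.aestronglyMeasurable hM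
    have h2 : ∀ a b : E d → ℝ, ∫ x in Metric.closedBall 0 r, a x * b x * u x
        = ∫ x, a x * b x * u x := fun a b =>
      setIntegral_eq_integral_of_forall_compl_eq_zero fun x hx => by simp [hr x hx]
    simpa only [h2] using h1
  have h1 := hlim hfl hfl hf hf hw'c hc'
  have h2 := (hlim hfl hgl hf hg hw.continuous hc).const_mul 2 |>.neg
  refine tendsto_nhds_unique h1 (h2.congr fun k => ?_)
  have hs := contDiff_mollify k hfl
  have hs' := contDiff_mollify k hgl
  have hd : ∀ x, HasFDerivAt (mollify k f) (fderiv ℝ (mollify k f) x) x := fun x =>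
    (hs.differentiable (by simp) x).hasFDerivAt
  have hd2 : ∀ x, fderiv ℝ (fun x => mollify k f x * mollify k f x) x v
      = 2 * (mollify k f x * mollify k g x) := by
    intro x
    rw [((hd x).fun_mul (hd x)).fderiv, ← fderiv_mollify k h]
    simp
    ring
  have hcf := hs.continuous
  have hcg := hs'.continuous
  have key := integral_mul_fderiv_eq_neg_fderiv_mul_of_integrable (μ := volume) (v := v)
    (f := fun x => mollify k f x * mollify k f x) (g := w) ?_ ?_ ?_ ?_ ?_
  · rw [key]
    simp only [hd2]
    rw [← integral_const_mul]
    congr 2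
    ext x
    ring
  · simp only [hd2]
    exact (by fun_prop : Continuous fun x => 2 * (mollify k f x * mollify k g x) * w x
      ).integrable_of_hasCompactSupport hc.mul_left
  · exact (by fun_prop : Continuous fun x => mollify k f x * mollify k f x * fderiv ℝ w x v
      ).integrable_of_hasCompactSupport hc'.mul_left
  · have := hw.continuous
    exact (by fun_prop : Continuous fun x => mollify k f x * mollify k f x * w x
      ).integrable_of_hasCompactSupport hc.mul_left
  · exact fun x _ => (hd x).differentiableAt.mul (hd x).differentiableAt
  · exact fun x _ => hw.differentiable (by simp) x

lemma sum_smul_single (x : E d) : ∑ i, x i • EuclideanSpace.single i (1 : ℝ) = x := by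
  ext j
  simp [Finset.sum_apply, Pi.single_apply]

/-- Integration by parts against a radial vector field `κ(x) x`. -/
lemma integral_sq_mul_radial {f : E d → ℝ} {G : E d → E d} (h : HasWeakGradient f G)
    (hf : LocL2 f) (hG : ∀ i, LocL2 fun x => G x i) {κ : E d → ℝ} (hκ : ContDiff ℝ 1 κ)
    (hc : HasCompactSupport κ) :
    ∫ x, f x * f x * (d * κ x + fderiv ℝ κ x x) = - (2 * ∫ x, f x * inner ℝ x (G x) * κ x) := by
  have hco : ∀ i : Fin d, ContDiff ℝ 1 fun x : E d => x i := fun i => by fun_prop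
  have hw : ∀ i : Fin d, ContDiff ℝ 1 fun x : E d => x i * κ x := fun i => (hco i).mul hκ
  have hwc : ∀ i : Fin d, HasCompactSupport fun x : E d => x i * κ x := fun i => hc.mul_left
  -- The test function in direction `i` is `x_i κ`; summing `∂_i(x_i κ)` gives the divergence `d κ +
  -- Dκ(x)`.
  have h1 := fun i => integral_sq_mul_fderiv (h i) hf (hG i) (hw i) (hwc i)
  have h2 := Finset.sum_congr (rfl : (Finset.univ : Finset (Fin d)) = Finset.univ)
    fun i _ => h1 i
  rw [← integral_finsetSum, Finset.sum_neg_distrib, ← Finset.mul_sum, ← integral_finsetSum] at h2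
  · have hl : ∀ x, f x * f x * (d * κ x + fderiv ℝ κ x x) = ∑ i, f x * f x *
        fderiv ℝ (fun x : E d => x i * κ x) x (EuclideanSpace.single i 1) := by
      intro x
      rw [← Finset.mul_sum]
      congr 1
      have hdx : ∀ i : Fin d, fderiv ℝ (fun x : E d => x i * κ x) x (EuclideanSpace.single i 1)
          = κ x + x i * fderiv ℝ κ x (EuclideanSpace.single i 1) := by
        intro i
        have e1 : HasFDerivAt (fun x : E d => x i) (EuclideanSpace.proj i : E d →L[ℝ] ℝ) x :=
          (EuclideanSpace.proj i : E d →L[ℝ] ℝ).hasFDerivAt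
        have e2 := e1.fun_mul (hκ.differentiable (by simp) x).hasFDerivAt
        rw [e2.fderiv]
        simp
        ring
      simp only [hdx, Finset.sum_add_distrib, Finset.sum_const, Finset.card_univ, Fintype.card_fin,
        nsmul_eq_mul]
      congr 1
      nth_rewrite 2 [← sum_smul_single x]
      rw [map_sum]
      simp
    have hr : ∀ x, f x * inner ℝ x (G x) * κ x = ∑ i, f x * G x i * (x i * κ x) := by
      intro x
      rw [PiLp.inner_apply, Finset.mul_sum, Finset.sum_mul]
      refine Finset.sum_congr rfl fun i _ => ?_
      simp
      ring
    simp only [hl, hr, h2]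
  · exact fun i _ => hf.integrable_mul_mul (hG i) (hw i).continuous (hwc i)
  · exact fun i _ => hf.integrable_mul_mul hf
      (((hw i).continuous_fderiv (by simp)).clm_apply continuous_const)
      ((hwc i).fderiv_apply ℝ _)

/-! ### The Lyapunov inequality -/

lemma inner_gradient_eq_fderiv {V : E d → ℝ} (x y : E d) :
    inner ℝ y (gradient V x) = fderiv ℝ V x y := by
  rw [real_inner_comm, gradient, InnerProductSpace.toDual_symm_apply]

/-- The root `s` is a smooth substitute for `‖x‖`: it stays above `R` near the origin and below
`2‖x‖` off the ball. -/
lemma sqrt_sq_add_sq_bounds {R r : ℝ} (hR : 0 < R) (hr : 0 ≤ r) :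
    0 < √(R ^ 2 + r ^ 2) ∧ r ≤ √(R ^ 2 + r ^ 2) ∧ R ≤ √(R ^ 2 + r ^ 2) ∧
      √(R ^ 2 + r ^ 2) ≤ R + r := by
  refine ⟨by positivity, Real.le_sqrt_of_sq_le (by nlinarith), Real.le_sqrt_of_sq_le (by nlinarith),
    Real.sqrt_le_iff.2 ⟨by positivity, by nlinarith [mul_nonneg hR.le hr]⟩⟩

/-- Lower bound for the Lyapunov weight far from the origin. -/
lemma lyapunov_weight_outside {δ η R r s m : ℝ} (hη : 0 < η)
    (hdR : 2 * δ / η ≤ R) (hr : R ≤ r) (hr0 : 0 < r) (hs : 0 < s) (hsr : s ≤ R + r)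
    (hm : η * r ≤ m) :
    η ^ 2 / 64 ≤ η / 8 * (m / s + r ^ 2 / s ^ 3 - δ / s) - (η / 8) ^ 2 := by
  -- From `δ ≤ ηR/2` and `R ≤ r`: `m - δ ≥ ηr - ηR/2 ≥ η(R + r)/4 ≥ ηs/4`. The slope `γ = η/8`
  -- maximises `γη/4 - γ²`, with value `η²/64`.
  have h1 : η / 4 ≤ m / s - δ / s := by
    rw [← sub_div, le_div_iff₀ hs]
    have : 2 * δ ≤ R * η := (div_le_iff₀ hη).1 hdR
    nlinarith [mul_le_mul_of_nonneg_right hr hη.le, mul_le_mul_of_nonneg_left hsr hη.le]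
  have h2 : 0 ≤ r ^ 2 / s ^ 3 := by positivity
  nlinarith [mul_le_mul_of_nonneg_left h1 hη.le, mul_nonneg hη.le h2]

/-- Lower bound for the Lyapunov weight near the origin. -/
lemma lyapunov_weight_inside {δ η R r s m g : ℝ} (hδ : 0 ≤ δ) (hη : 0 < η) (hR : 0 < R)
    (hs : 0 < s) (hrs : r ≤ s) (hRs : R ≤ s) (hg : 0 ≤ g) (hm : -(g * r) ≤ m) :
    -(η / 8 * g + η / 8 * δ / R + (η / 8) ^ 2)
      ≤ η / 8 * (m / s + r ^ 2 / s ^ 3 - δ / s) - (η / 8) ^ 2 := by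
  have h1 : -g ≤ m / s := by
    rw [le_div_iff₀ hs]
    nlinarith
  have h2 : 0 ≤ r ^ 2 / s ^ 3 := by positivity
  have h3 : δ / s ≤ δ / R := div_le_div_of_nonneg_left hδ hR hRs
  have h4 : η / 8 * δ / R = η / 8 * (δ / R) := by ring
  rw [h4]
  nlinarith

lemma contDiff_inv_sqrt {R : ℝ} (hR : 0 < R) :
    ContDiff ℝ 1 fun x : E d => (√(R ^ 2 + ‖x‖ ^ 2))⁻¹ := by
  have h1 : ContDiff ℝ 1 fun x : E d => R ^ 2 + ‖x‖ ^ 2 := contDiff_const.add (contDiff_norm_sq ℝ)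
  exact (h1.sqrt fun x => by positivity).inv fun x => by positivity

lemma fderiv_inv_sqrt {R : ℝ} (hR : 0 < R) (x : E d) :
    fderiv ℝ (fun x : E d => (√(R ^ 2 + ‖x‖ ^ 2))⁻¹) x x
      = - (‖x‖ ^ 2 / √(R ^ 2 + ‖x‖ ^ 2) ^ 3) := by
  have hp : 0 < R ^ 2 + ‖x‖ ^ 2 := by positivity
  have h1 : HasFDerivAt (fun x : E d => R ^ 2 + ‖x‖ ^ 2) (2 • innerSL ℝ x) x :=
    ((hasStrictFDerivAt_norm_sq x).hasFDerivAt).const_add _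
  have h2 := (hasDerivAt_inv (Real.sqrt_pos.2 hp).ne').comp_hasFDerivAt x (h1.sqrt hp.ne')
  have h3 : HasFDerivAt (fun x : E d => (√(R ^ 2 + ‖x‖ ^ 2))⁻¹) _ x := h2
  rw [h3.fderiv]
  have hs : √(R ^ 2 + ‖x‖ ^ 2) ≠ 0 := (Real.sqrt_pos.2 hp).ne'
  simp
  field_simp

/-- The rescaled cutoff functions. -/
def cutoff (d n : ℕ) (x : E d) : ℝ :=
  (⟨1, 2, one_pos, one_lt_two⟩ : ContDiffBump (0 : E d)) (((n : ℝ) + 1)⁻¹ • x)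

lemma contDiff_cutoff (n : ℕ) : ContDiff ℝ 1 (cutoff d n) :=
  (ContDiffBump.contDiff _).comp (contDiff_id.const_smul _)

lemma cutoff_nonneg (n : ℕ) (x : E d) : 0 ≤ cutoff d n x := ContDiffBump.nonneg _

lemma cutoff_le_one (n : ℕ) (x : E d) : cutoff d n x ≤ 1 := ContDiffBump.le_one _

lemma hasCompactSupport_cutoff (n : ℕ) : HasCompactSupport (cutoff d n) :=
  (ContDiffBump.hasCompactSupport _).comp_homeomorph
    (Homeomorph.smulOfNeZero ((n : ℝ) + 1)⁻¹ (by positivity))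

lemma tendsto_cutoff (x : E d) : Tendsto (fun n => cutoff d n x) atTop (𝓝 1) := by
  refine tendsto_const_nhds.congr' ?_
  obtain ⟨N, hN⟩ := exists_nat_gt ‖x‖
  filter_upwards [eventually_ge_atTop N] with n hn
  symm
  refine ContDiffBump.one_of_mem_closedBall _ ?_
  rw [mem_closedBall_zero_iff, norm_smul, norm_inv, Real.norm_of_nonneg (by positivity),
    inv_mul_le_iff₀ (by positivity)]
  have : (N : ℝ) ≤ n := by exact_mod_cast hn
  simp
  linarith

/-- Rescaling makes the gradient of the cutoff `O(1/n)`; the factor `‖x‖` is later absorbed by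
`1/s`. -/
lemma exists_fderiv_cutoff_bound (d : ℕ) :
    ∃ c : ℝ, ∀ n (x : E d), |fderiv ℝ (cutoff d n) x x| ≤ c / ((n : ℝ) + 1) * ‖x‖ := by
  let φ : ContDiffBump (0 : E d) := ⟨1, 2, one_pos, one_lt_two⟩
  have hφ : ContDiff ℝ 1 φ := φ.contDiff
  obtain ⟨c, hc⟩ := (φ.hasCompactSupport.fderiv ℝ).exists_bound_of_continuous
    (hφ.continuous_fderiv (by simp))
  refine ⟨c, fun n x => ?_⟩
  have h1 := ((hφ.differentiable (by simp) (((n : ℝ) + 1)⁻¹ • x)).hasFDerivAt).comp x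
    ((hasFDerivAt_id x).const_smul ((n : ℝ) + 1)⁻¹)
  have h2 : HasFDerivAt (cutoff d n) _ x := h1
  rw [h2.fderiv, ← Real.norm_eq_abs]
  simp only [ContinuousLinearMap.comp_apply, _root_.smul_apply,
    ContinuousLinearMap.id_apply, map_smul, norm_smul, norm_inv]
  rw [Real.norm_of_nonneg (by positivity), inv_mul_eq_div, div_mul_eq_mul_div]
  gcongr
  exact (ContinuousLinearMap.le_opNorm _ _).trans (by gcongr; exact hc _)

/-- The pointwise estimate behind the Lyapunov inequality. -/
lemma lyapunov_pointwise {f N e χ k c i r s q δ γ m θ B : ℝ} (he : 0 < e) (hχ : 0 ≤ χ) (hχ1 : χ ≤ 1)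
    (hs : 0 < s) (hr : 0 ≤ r) (hrs : r ≤ s) (hγ : 0 ≤ γ) (hi : |i| ≤ r * N) (hk : |k| ≤ c * r)
    (hc : 0 ≤ c) (hB : 0 ≤ B)
    (hq : q = γ * (m / s + r ^ 2 / s ^ 3 - δ / s) - γ ^ 2) (hqθ : θ - B ≤ q) :
    θ * (f * f * χ * e) ≤ N ^ 2 * e + B * (f * f * e) + γ * c * (f * f * e)
      - f * f * (δ * (γ * s⁻¹ * χ * e)
        + γ * e * (s⁻¹ * k - χ * (r ^ 2 / s ^ 3) - s⁻¹ * χ * m))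
      - 2 * (f * i * (γ * s⁻¹ * χ * e)) := by
  have hN : 0 ≤ N ∨ r = 0 := by
    by_contra! h
    have := abs_nonneg i
    have h3 : 0 < r := lt_of_le_of_ne hr (Ne.symm h.2)
    nlinarith [mul_neg_of_pos_of_neg h3 h.1]
  have h1 : s⁻¹ * k ≤ c := by
    rw [inv_mul_le_iff₀ hs]
    nlinarith [le_abs_self k, mul_le_mul_of_nonneg_left hrs hc]
  have h2 : |s⁻¹ * i| ≤ |N| := by
    rw [abs_mul, abs_of_pos (inv_pos.2 hs), inv_mul_le_iff₀ hs]
    calc |i| ≤ r * N := hi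
      _ ≤ r * |N| := by gcongr; exact le_abs_self N
      _ ≤ s * |N| := by gcongr
  have h3 : (s⁻¹ * i) ^ 2 ≤ N ^ 2 := sq_le_sq.2 h2
  -- Young's inequality for the cross term; its price `γ² f²` is exactly what is subtracted in `q`.
  have h4 : 2 * (f * (s⁻¹ * i) * γ) ≤ N ^ 2 + γ ^ 2 * (f * f) := by
    nlinarith [sq_nonneg (s⁻¹ * i - γ * f)]
  have hff : 0 ≤ f * f := mul_self_nonneg f
  have hqm : q + γ ^ 2 = γ * (s⁻¹ * m + r ^ 2 / s ^ 3 - δ * s⁻¹) := by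
    rw [hq]; field_simp; ring
  have key : θ * (f * f * χ) ≤ N ^ 2 + B * (f * f) + γ * c * (f * f)
      - f * f * (δ * (γ * s⁻¹ * χ) + γ * (s⁻¹ * k - χ * (r ^ 2 / s ^ 3) - s⁻¹ * χ * m))
      - 2 * (f * i * (γ * s⁻¹ * χ)) := by
    have e1 : f * f * (δ * (γ * s⁻¹ * χ) + γ * (s⁻¹ * k - χ * (r ^ 2 / s ^ 3) - s⁻¹ * χ * m))
        = γ * (f * f) * (s⁻¹ * k) - f * f * χ * (q + γ ^ 2) := by
      rw [hqm]; ring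
    have e2 : 2 * (f * i * (γ * s⁻¹ * χ)) = χ * (2 * (f * (s⁻¹ * i) * γ)) := by ring
    rw [e1, e2]
    have i1 := mul_le_mul_of_nonneg_left h4 hχ
    have i2 := mul_le_mul_of_nonneg_left h1 (mul_nonneg hγ hff)
    have i3 := mul_le_mul_of_nonneg_left hqθ (mul_nonneg hff hχ)
    have i4 : χ * N ^ 2 ≤ N ^ 2 := mul_le_of_le_one_left (sq_nonneg N) hχ1
    have i5 : χ * (B * (f * f)) ≤ B * (f * f) := mul_le_of_le_one_left (mul_nonneg hB hff) hχ1
    nlinarith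
  nlinarith [mul_le_mul_of_nonneg_right key he.le]

/-- The field `γ e^{-V} x / s` is not compactly supported, so it is multiplied by the cutoffs. Their
error is at most `O(1/n) ∫ f² e^{-V}` and disappears in the limit. -/
lemma lyapunov_inequality {V : E d → ℝ} (hV : ContDiff ℝ 1 V) {f : E d → ℝ} {G : E d → E d}
    (h : HasWeakGradient f G) (hf : LocL2 f) (hG : ∀ i, LocL2 fun x => G x i)
    (hfi : Integrable (fun x => f x * f x * Real.exp (-V x)) volume)
    (hGi : Integrable (fun x => ‖G x‖ ^ 2 * Real.exp (-V x)) volume)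
    {η R g : ℝ} (hη : 0 < η) (hR : 0 < R) (hdR : 2 * d / η ≤ R)
    (hdrift : ∀ x, R ≤ ‖x‖ → η * ‖x‖ ≤ inner ℝ x (gradient V x)) (hg0 : 0 ≤ g)
    (hg : ∀ x ∈ Metric.closedBall (0 : E d) R, ‖gradient V x‖ ≤ g) :
    η ^ 2 / 64 * ∫ x, f x * f x * Real.exp (-V x) ≤ (∫ x, ‖G x‖ ^ 2 * Real.exp (-V x))
      + (η ^ 2 / 64 + (η / 8 * g + η / 8 * d / R + (η / 8) ^ 2)) *
        ∫ x in Metric.closedBall 0 R, f x * f x * Real.exp (-V x) := by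
  -- The deficit on the ball: the most that `q` can fall short of the level `η²/64`. Off the ball
  -- the pointwise estimate is used with deficit 0.
  set B := η ^ 2 / 64 + (η / 8 * g + η / 8 * d / R + (η / 8) ^ 2) with hB
  have hB0 : 0 ≤ B := by positivity
  obtain ⟨c₀, hc₀⟩ := exists_fderiv_cutoff_bound d
  set c := |c₀| with hc
  have hcut : ∀ n (x : E d), |fderiv ℝ (cutoff d n) x x| ≤ c / ((n : ℝ) + 1) * ‖x‖ := fun n x =>
    (hc₀ n x).trans (by gcongr; exact le_abs_self c₀)
  have hVc := hV.continuous
  set I := ∫ x, f x * f x * Real.exp (-V x) with hI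
  set J := ∫ x, ‖G x‖ ^ 2 * Real.exp (-V x) with hJ
  set K := ∫ x in Metric.closedBall 0 R, f x * f x * Real.exp (-V x) with hK
  have step : ∀ n : ℕ, η ^ 2 / 64 * ∫ x, f x * f x * Real.exp (-V x) * cutoff d n x
      ≤ J + B * K + η / 8 * (c / ((n : ℝ) + 1)) * I := by
    intro n
    let κ : E d → ℝ := fun x =>
      η / 8 * (√(R ^ 2 + ‖x‖ ^ 2))⁻¹ * cutoff d n x * Real.exp (-V x)
    have hκ : ContDiff ℝ 1 κ :=
      ((contDiff_const.mul (contDiff_inv_sqrt hR)).mul (contDiff_cutoff n)).mul hV.neg.exp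
    have hκc : HasCompactSupport κ := (hasCompactSupport_cutoff n).mul_left.mul_right
    have hdκ : ∀ x, fderiv ℝ κ x x = η / 8 * Real.exp (-V x) *
        ((√(R ^ 2 + ‖x‖ ^ 2))⁻¹ * fderiv ℝ (cutoff d n) x x
          - cutoff d n x * (‖x‖ ^ 2 / √(R ^ 2 + ‖x‖ ^ 2) ^ 3)
          - (√(R ^ 2 + ‖x‖ ^ 2))⁻¹ * cutoff d n x * fderiv ℝ V x x) := by
      intro x
      have d1 := ((contDiff_inv_sqrt (d := d) hR).differentiable (by simp) x).hasFDerivAt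
      have d2 := ((contDiff_cutoff (d := d) n).differentiable (by simp) x).hasFDerivAt
      have d3 := (hV.differentiable (by simp) x).hasFDerivAt.fun_neg.exp
      have d4 := ((d1.const_mul (η / 8)).fun_mul d2).fun_mul d3
      rw [show fderiv ℝ κ x = _ from d4.fderiv]
      have := fderiv_inv_sqrt hR x
      simp [this]
      ring
    have key := integral_sq_mul_radial h hf hG hκ hκc
    have hI1 : Integrable (fun x => f x * f x * (d * κ x + fderiv ℝ κ x x)) volume := by
      have hc1 : Continuous fun x => fderiv ℝ κ x x :=
        (hκ.continuous_fderiv (by simp)).clm_apply continuous_id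
      have hc2 := hκ.continuous
      refine hf.integrable_mul_mul hf (by fun_prop) ?_
      refine HasCompactSupport.add hκc.mul_left ?_
      refine (hκc.fderiv ℝ).mono fun x hx hx' => hx ?_
      simp [hx']
    have hI2 : Integrable (fun x => f x * inner ℝ x (G x) * κ x) volume := by
      have hr : ∀ x, f x * inner ℝ x (G x) * κ x = ∑ i, f x * G x i * (x i * κ x) := by
        intro x
        rw [PiLp.inner_apply, Finset.mul_sum, Finset.sum_mul]
        refine Finset.sum_congr rfl fun i _ => ?_
        simp
        ring
      simp only [hr]
      have hc2 := hκ.continuous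
      exact integrable_finsetSum _ fun i _ =>
        hf.integrable_mul_mul (hG i) (by fun_prop) hκc.mul_left
    have hI3 : Integrable ((Metric.closedBall (0 : E d) R).indicator
        fun x => f x * f x * Real.exp (-V x)) volume :=
      hfi.indicator measurableSet_closedBall
    have hI4 : Integrable (fun x => f x * f x * Real.exp (-V x) * cutoff d n x) volume :=
      hfi.mul_bdd (c := 1) (contDiff_cutoff n).continuous.aestronglyMeasurable
        (Eventually.of_forall fun x => by
          rw [Real.norm_of_nonneg (cutoff_nonneg n x)]; exact cutoff_le_one n x)
    have hle : ∀ x, η ^ 2 / 64 * (f x * f x * Real.exp (-V x) * cutoff d n x)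
        ≤ ‖G x‖ ^ 2 * Real.exp (-V x) + B * (Metric.closedBall (0 : E d) R).indicator
          (fun x => f x * f x * Real.exp (-V x)) x
          + η / 8 * (c / ((n : ℝ) + 1)) * (f x * f x * Real.exp (-V x))
          - f x * f x * (d * κ x + fderiv ℝ κ x x) - 2 * (f x * inner ℝ x (G x) * κ x) := by
      intro x
      obtain ⟨hs, hrs, hRs, hsr⟩ := sqrt_sq_add_sq_bounds hR (norm_nonneg x)
      have hi : |inner ℝ x (G x)| ≤ ‖x‖ * ‖G x‖ := abs_real_inner_le_norm _ _
      rw [hdκ x]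
      by_cases hx : x ∈ Metric.closedBall (0 : E d) R
      · have hm : -(g * ‖x‖) ≤ fderiv ℝ V x x := by
          rw [← inner_gradient_eq_fderiv]
          have h1 := abs_real_inner_le_norm x (gradient V x)
          have h2 := neg_abs_le (inner ℝ x (gradient V x))
          have h3 := mul_le_mul_of_nonneg_left (hg x hx) (norm_nonneg x)
          linarith
        have hq := lyapunov_weight_inside (Nat.cast_nonneg d) hη hR hs hrs hRs
          hg0 hm
        have := lyapunov_pointwise (f := f x) (δ := d) (m := fderiv ℝ V x x)
          (θ := η ^ 2 / 64) (B := B) (Real.exp_pos (-V x))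
          (cutoff_nonneg n x) (cutoff_le_one n x) hs (norm_nonneg x) hrs (by positivity : 0 ≤ η / 8)
          hi (hcut n x) (by positivity) hB0 rfl (by rw [hB]; linarith)
        rw [indicator_of_mem hx]
        convert this using 1
        ring
      · have hx' : R ≤ ‖x‖ := by
          have : R < ‖x‖ := by simpa using hx
          exact this.le
        have hm : η * ‖x‖ ≤ fderiv ℝ V x x := by
          rw [← inner_gradient_eq_fderiv]
          exact hdrift x hx'
        have hq := lyapunov_weight_outside hη hdR hx' (hR.trans_le hx') hs hsr
          hm
        have := lyapunov_pointwise (f := f x) (δ := d) (m := fderiv ℝ V x x)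
          (θ := η ^ 2 / 64) (B := 0) (Real.exp_pos (-V x))
          (cutoff_nonneg n x) (cutoff_le_one n x) hs (norm_nonneg x) hrs (by positivity : 0 ≤ η / 8)
          hi (hcut n x) (by positivity) le_rfl rfl (by linarith)
        rw [indicator_of_notMem hx]
        convert this using 1
        · ring
        · simp [κ]
    have hmono := integral_mono (hI4.const_mul _) (((((hGi.add (hI3.const_mul B)).add
      (hfi.const_mul (η / 8 * (c / ((n : ℝ) + 1))))).sub hI1).sub (hI2.const_mul 2))) hle
    rw [integral_const_mul, integral_sub' ((((hGi.add (hI3.const_mul B)).add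
      (hfi.const_mul (η / 8 * (c / ((n : ℝ) + 1))))).sub hI1)) (hI2.const_mul 2),
      integral_sub' (((hGi.add (hI3.const_mul B)).add
      (hfi.const_mul (η / 8 * (c / ((n : ℝ) + 1)))))) hI1,
      integral_add' ((hGi.add (hI3.const_mul B))) (hfi.const_mul (η / 8 * (c / ((n : ℝ) + 1)))),
      integral_add' hGi (hI3.const_mul B), integral_const_mul, integral_const_mul,
      integral_const_mul, integral_indicator measurableSet_closedBall, key] at hmono
    linarith
  have hlim1 : Tendsto (fun n : ℕ => ∫ x, f x * f x * Real.exp (-V x) * cutoff d n x) atTop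
      (𝓝 I) := by
    refine tendsto_integral_of_dominated_convergence (fun x => f x * f x * Real.exp (-V x))
      (fun n => hfi.1.mul (contDiff_cutoff n).continuous.aestronglyMeasurable) hfi
      (fun n => Eventually.of_forall fun x => ?_) (Eventually.of_forall fun x => ?_)
    · rw [norm_mul, Real.norm_of_nonneg (cutoff_nonneg n x), Real.norm_of_nonneg
        (mul_nonneg (mul_self_nonneg _) (Real.exp_pos _).le)]
      exact mul_le_of_le_one_right (mul_nonneg (mul_self_nonneg _) (Real.exp_pos _).le)
        (cutoff_le_one n x)
    · simpa using (tendsto_cutoff x).const_mul (f x * f x * Real.exp (-V x))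
  have hlim2 : Tendsto (fun n : ℕ => J + B * K + η / 8 * (c / ((n : ℝ) + 1)) * I) atTop
      (𝓝 (J + B * K)) := by
    have h1 := ((tendsto_one_div_add_atTop_nhds_zero_nat (𝕜 := ℝ)).const_mul (η / 8 * c)).mul_const I
    have h2 := h1.const_add (J + B * K)
    simp only [mul_zero, zero_mul, add_zero] at h2
    refine h2.congr fun n => ?_
    ring
  exact le_of_tendsto_of_tendsto' (hlim1.const_mul _) hlim2 step

/-! ### The Poincaré inequality on a ball -/

lemma norm_gradient_eq (f : E d → ℝ) (x : E d) : ‖gradient f x‖ = ‖fderiv ℝ f x‖ := by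
  rw [gradient, LinearIsometryEquiv.norm_map]

instance : IsProbabilityMeasure ((volume : Measure ℝ).restrict (Icc (0 : ℝ) 1)) :=
  ⟨by simp⟩

lemma continuous_gradient {f : E d → ℝ} (hf : ContDiff ℝ 1 f) : Continuous (gradient f) :=
  (InnerProductSpace.toDual ℝ (E d)).symm.continuous.comp (hf.continuous_fderiv (by simp))

/-- Fundamental theorem of calculus along the segment, then Jensen in `t`. -/
lemma enorm_sub_sq_le {f : E d → ℝ} (hf : ContDiff ℝ 1 f) (x y : E d) :
    ‖f x - f y‖ₑ ^ 2
      ≤ ‖x - y‖ₑ ^ 2 * ∫⁻ t in Icc (0 : ℝ) 1, ‖gradient f ((1 - t) • x + t • y)‖ₑ ^ 2 := by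
  have hline : ∀ t : ℝ, HasDerivAt (fun t : ℝ => (1 - t) • x + t • y) (y - x) t := by
    intro t
    have h1 := ((hasDerivAt_id t).const_sub 1).smul_const x
    have h2 := (hasDerivAt_id t).smul_const y
    have h3 : HasDerivAt (fun t : ℝ => (1 - t) • x + t • y) _ t := h1.add h2
    convert h3 using 1
    simp
    abel
  have hder : ∀ t : ℝ, HasDerivAt (fun t : ℝ => f ((1 - t) • x + t • y))
      (fderiv ℝ f ((1 - t) • x + t • y) (y - x)) t := fun t =>
    ((hf.differentiable (by simp) _).hasFDerivAt).comp_hasDerivAt t (hline t)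
  have hcont : Continuous fun t : ℝ => fderiv ℝ f ((1 - t) • x + t • y) (y - x) := by
    have := hf.continuous_fderiv (by simp)
    fun_prop
  have hftc : f y - f x
      = ∫ t in Icc (0 : ℝ) 1, fderiv ℝ f ((1 - t) • x + t • y) (y - x) := by
    rw [integral_Icc_eq_integral_Ioc, ← intervalIntegral.integral_of_le zero_le_one,
      intervalIntegral.integral_eq_sub_of_hasDerivAt (fun t _ => hder t)
        (hcont.intervalIntegrable _ _)]
    simp
  rw [show f x - f y = -(f y - f x) by ring, enorm_neg, hftc]
  refine (enorm_sq_integral_le _ hcont.measurable.aemeasurable).trans ?_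
  rw [← lintegral_const_mul' _ _ (ENNReal.pow_ne_top enorm_ne_top)]
  refine lintegral_mono fun t => ?_
  rw [← mul_pow]
  gcongr
  rw [← ofReal_norm, ← ofReal_norm, ← ofReal_norm,
    ← ENNReal.ofReal_mul (norm_nonneg _), norm_gradient_eq]
  refine ENNReal.ofReal_le_ofReal ?_
  rw [mul_comm, norm_sub_rev x y]
  exact ContinuousLinearMap.le_opNorm _ _

/-- The Jacobian of `y ↦ a + t y` contributes `t^{-d} ≤ 2^d`. -/
lemma lintegral_comp_add_smul_le {h : E d → ENNReal} (hh : Measurable h) (a : E d) {t : ℝ}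
    (ht : 1 / 2 ≤ t) : ∫⁻ y, h (a + t • y) ≤ 2 ^ d * ∫⁻ y, h y := by
  have ht0 : 0 < t := by linarith
  have h1 : ∫⁻ y, h (a + t • y) = ∫⁻ z, h (a + z) ∂(Measure.map (t • ·) (volume : Measure (E d))) :=
    (lintegral_map (f := fun z => h (a + z)) (hh.comp (measurable_const_add a))
      (measurable_const_smul t)).symm
  rw [h1, Measure.map_addHaar_smul _ ht0.ne', lintegral_smul_measure,
    lintegral_add_left_eq_self (fun z => h z) a, smul_eq_mul]
  gcongr
  rw [finrank_euclideanSpace_fin, abs_of_nonneg (by positivity), ← inv_pow,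
    ENNReal.ofReal_pow (by positivity)]
  gcongr
  rw [show (2 : ENNReal) = ENNReal.ofReal 2 by simp]
  refine ENNReal.ofReal_le_ofReal ?_
  rw [inv_le_comm₀ ht0 (by norm_num)]
  linarith

/-- One of `t` and `1 - t` is at least `1/2`. Integrating first over the point carrying that
coefficient, extended to the whole space, costs `2^d`; the other point contributes `volume S`. -/
lemma lintegral_lintegral_convex_le {h : E d → ENNReal} (hh : Measurable h) (S : Set (E d)) (t : ℝ) :
    ∫⁻ x in S, ∫⁻ y in S, h ((1 - t) • x + t • y) ≤ 2 ^ d * volume S * ∫⁻ z, h z := by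
  rcases le_total (1 / 2) t with ht | ht
  · calc _ ≤ ∫⁻ x in S, 2 ^ d * ∫⁻ z, h z :=
          lintegral_mono fun x => (lintegral_mono' Measure.restrict_le_self le_rfl).trans
            (lintegral_comp_add_smul_le hh _ ht)
      _ = _ := by rw [setLIntegral_const]; ring
  · have hm : Measurable (Function.uncurry fun x y : E d => h ((1 - t) • x + t • y)) := by
      unfold Function.uncurry
      fun_prop
    rw [lintegral_lintegral_swap hm.aemeasurable]
    calc _ ≤ ∫⁻ x in S, 2 ^ d * ∫⁻ z, h z := by
          refine lintegral_mono fun y => (lintegral_mono' Measure.restrict_le_self le_rfl).trans ?_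
          simp only [add_comm _ (t • y)]
          exact lintegral_comp_add_smul_le hh _ (by linarith)
      _ = _ := by rw [setLIntegral_const]; ring

lemma lintegral_lintegral_lintegral_comm {h : E d → ENNReal} (hh : Measurable h) (B : Set (E d)) :
    ∫⁻ x in B, ∫⁻ y in B, ∫⁻ t in Icc (0 : ℝ) 1, h ((1 - t) • x + t • y)
      = ∫⁻ t in Icc (0 : ℝ) 1, ∫⁻ x in B, ∫⁻ y in B, h ((1 - t) • x + t • y) := by
  have hm3 : Measurable fun p : (E d × ℝ) × E d => h ((1 - p.1.2) • p.1.1 + p.1.2 • p.2) := by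
    fun_prop
  have e2 : ∀ x : E d, ∫⁻ y in B, ∫⁻ t in Icc (0 : ℝ) 1, h ((1 - t) • x + t • y)
      = ∫⁻ t in Icc (0 : ℝ) 1, ∫⁻ y in B, h ((1 - t) • x + t • y) := by
    intro x
    have hm : Measurable fun p : E d × ℝ => h ((1 - p.2) • x + p.2 • p.1) := by fun_prop
    exact lintegral_lintegral_swap hm.aemeasurable
  simp only [e2]
  have hm4 : Measurable fun p : E d × ℝ => ∫⁻ y in B, h ((1 - p.2) • p.1 + p.2 • y) :=
    hm3.lintegral_prod_right'
  exact lintegral_lintegral_swap hm4.aemeasurable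

lemma lintegral_lintegral_sub_sq_le {f : E d → ℝ} (hf : ContDiff ℝ 1 f) {R : ℝ} :
    ∫⁻ x in Metric.closedBall (0 : E d) R, ∫⁻ y in Metric.closedBall (0 : E d) R, ‖f x - f y‖ₑ ^ 2
      ≤ ENNReal.ofReal (2 * R) ^ 2 * (2 ^ d * volume (Metric.closedBall (0 : E d) R) *
        ∫⁻ z in Metric.closedBall (0 : E d) R, ‖gradient f z‖ₑ ^ 2) := by
  set B := Metric.closedBall (0 : E d) R with hB
  have hBm : MeasurableSet B := measurableSet_closedBall
  have hgm : Measurable fun z => ‖gradient f z‖ₑ ^ 2 :=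
    (continuous_gradient hf).measurable.enorm.pow_const 2
  -- Extension by zero allows the change of variables on the whole space. Nothing is lost, since by
  -- convexity the segments stay in the ball.
  let h : E d → ENNReal := B.indicator fun z => ‖gradient f z‖ₑ ^ 2
  have hh : Measurable h := hgm.indicator hBm
  have hpt : ∀ x ∈ B, ∀ y ∈ B, ‖f x - f y‖ₑ ^ 2 ≤ ENNReal.ofReal (2 * R) ^ 2 *
      ∫⁻ t in Icc (0 : ℝ) 1, h ((1 - t) • x + t • y) := by
    intro x hx y hy
    refine (enorm_sub_sq_le hf x y).trans (mul_le_mul' (pow_le_pow_left' ?_ 2) ?_)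
    · rw [← ofReal_norm]
      refine ENNReal.ofReal_le_ofReal ?_
      have h1 : ‖x‖ ≤ R := by simpa [hB] using hx
      have h2 : ‖y‖ ≤ R := by simpa [hB] using hy
      linarith [norm_sub_le x y]
    · refine setLIntegral_mono' measurableSet_Icc fun t ht => ?_
      have : (1 - t) • x + t • y ∈ B :=
        convex_closedBall (0 : E d) R hx hy (by linarith [ht.2]) ht.1 (by ring)
      exact (indicator_of_mem this fun z => ‖gradient f z‖ₑ ^ 2).ge
  have hc : ENNReal.ofReal (2 * R) ^ 2 ≠ ⊤ := ENNReal.pow_ne_top ENNReal.ofReal_ne_top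
  calc _ ≤ ∫⁻ x in B, ∫⁻ y in B, ENNReal.ofReal (2 * R) ^ 2 *
          ∫⁻ t in Icc (0 : ℝ) 1, h ((1 - t) • x + t • y) :=
        setLIntegral_mono' hBm fun x hx => setLIntegral_mono' hBm fun y hy => hpt x hx y hy
    _ = ENNReal.ofReal (2 * R) ^ 2 * ∫⁻ t in Icc (0 : ℝ) 1, ∫⁻ x in B, ∫⁻ y in B,
          h ((1 - t) • x + t • y) := by
        simp_rw [lintegral_const_mul' _ _ hc]
        rw [lintegral_lintegral_lintegral_comm hh]
    _ ≤ ENNReal.ofReal (2 * R) ^ 2 * ∫⁻ t in Icc (0 : ℝ) 1, 2 ^ d * volume B * ∫⁻ z, h z :=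
        mul_le_mul' le_rfl (lintegral_mono fun t => lintegral_lintegral_convex_le hh B t)
    _ = _ := by
        rw [lintegral_const, measure_univ, mul_one, lintegral_indicator hBm]

lemma integral_sub_sq {α : Type*} [MeasurableSpace α] {μ : Measure α} [IsFiniteMeasure μ]
    {f : α → ℝ} (hf : MemLp f 2 μ) (c : ℝ) :
    ∫ y, (c - f y) ^ 2 ∂μ
      = μ.real univ * (c * c) - 2 * (∫ y, f y ∂μ) * c + ∫ y, f y * f y ∂μ := by
  have h1 : Integrable f μ := hf.integrable (by norm_num)
  have h2 : Integrable (fun x => f x * f x) μ := hf.integrable_mul hf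
  have h3 : Integrable (fun y => 2 * c * f y) μ := h1.const_mul _
  have h4 : Integrable (fun y => c * c - 2 * c * f y) μ := (integrable_const _).sub h3
  have : ∀ y, (c - f y) ^ 2 = c * c - 2 * c * f y + f y * f y := fun y => by ring
  simp only [this]
  rw [integral_add h4 h2, integral_sub (integrable_const _) h3, integral_const, integral_const_mul]
  simp only [smul_eq_mul]
  ring

lemma integrable_integral_sub_sq {α : Type*} [MeasurableSpace α] {μ : Measure α}
    [IsFiniteMeasure μ] {f : α → ℝ} (hf : MemLp f 2 μ) :
    Integrable (fun x => ∫ y, (f x - f y) ^ 2 ∂μ) μ := by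
  have h1 : Integrable f μ := hf.integrable (by norm_num)
  have h2 : Integrable (fun x => f x * f x) μ := hf.integrable_mul hf
  simp only [integral_sub_sq hf]
  exact ((h2.const_mul _).sub (h1.const_mul _)).add (integrable_const _)

/-- The double-integral form of the variance, which lets the segment estimate yield a Poincaré
inequality without mentioning the mean. -/
lemma integral_integral_sub_sq {α : Type*} [MeasurableSpace α] {μ : Measure α} [IsFiniteMeasure μ]
    {f : α → ℝ} (hf : MemLp f 2 μ) :
    ∫ x, ∫ y, (f x - f y) ^ 2 ∂μ ∂μ
      = 2 * μ.real univ * (∫ x, f x * f x ∂μ) - 2 * (∫ x, f x ∂μ) ^ 2 := by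
  have h1 : Integrable f μ := hf.integrable (by norm_num)
  have h2 : Integrable (fun x => f x * f x) μ := hf.integrable_mul hf
  have h3 : Integrable (fun x => μ.real univ * (f x * f x)) μ := h2.const_mul _
  have h4 : Integrable (fun x => 2 * (∫ y, f y ∂μ) * f x) μ := h1.const_mul _
  have h5 : Integrable (fun x => μ.real univ * (f x * f x) - 2 * (∫ y, f y ∂μ) * f x) μ :=
    h3.sub h4
  simp only [integral_sub_sq hf]
  rw [integral_add h5 (integrable_const _), integral_sub h3 h4, integral_const_mul,
    integral_const_mul, integral_const]
  simp only [smul_eq_mul]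
  ring

lemma ofReal_integral_sq {α : Type*} [MeasurableSpace α] {μ : Measure α} {F : Type*}
    [NormedAddCommGroup F] {f : α → F} (hf : MemLp f 2 μ) :
    ENNReal.ofReal (∫ x, ‖f x‖ ^ 2 ∂μ) = ∫⁻ x, ‖f x‖ₑ ^ 2 ∂μ := by
  rw [ofReal_integral_eq_lintegral_ofReal hf.norm.integrable_sq
    (Eventually.of_forall fun x => sq_nonneg _)]
  refine lintegral_congr fun x => ?_
  rw [ENNReal.ofReal_pow (norm_nonneg _), ofReal_norm]

lemma ball_poincare_smooth {f : E d → ℝ} (hf : ContDiff ℝ 1 f) {R : ℝ} (hR : 0 < R) :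
    2 * volume.real (Metric.closedBall (0 : E d) R) * (∫ x in Metric.closedBall (0 : E d) R, f x * f x)
        - 2 * (∫ x in Metric.closedBall (0 : E d) R, f x) ^ 2
      ≤ (2 * R) ^ 2 * (2 ^ d * volume.real (Metric.closedBall (0 : E d) R) *
        ∫ x in Metric.closedBall (0 : E d) R, ‖gradient f x‖ ^ 2) := by
  have hf2 := memLp_restrict_of_continuous hf.continuous R
  have hg2 := memLp_restrict_of_continuous (continuous_gradient hf) R
  have h1 := lintegral_lintegral_sub_sq_le (R := R) hf
  have h2 := integral_integral_sub_sq hf2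
  rw [measureReal_restrict_apply_univ] at h2
  rw [← h2]
  rw [← ENNReal.ofReal_le_ofReal_iff (by positivity), ENNReal.ofReal_mul (by positivity),
    ENNReal.ofReal_mul (by positivity), ENNReal.ofReal_mul (by positivity),
    ofReal_integral_sq hg2, measureReal_def, ENNReal.ofReal_toReal measure_closedBall_lt_top.ne,
    ENNReal.ofReal_pow (by positivity), ENNReal.ofReal_pow (by positivity)]
  simp only [ENNReal.ofReal_ofNat]
  refine le_trans (le_of_eq ?_) h1
  have hsub : ∀ x, MemLp (fun y => f x - f y) 2
      (volume.restrict (Metric.closedBall (0 : E d) R)) := fun x =>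
    memLp_restrict_of_continuous (continuous_const.sub hf.continuous) R
  have e1 : ∀ x, ∫⁻ y in Metric.closedBall (0 : E d) R, ‖f x - f y‖ₑ ^ 2
      = ENNReal.ofReal (∫ y in Metric.closedBall (0 : E d) R, (f x - f y) ^ 2) := by
    intro x
    rw [← ofReal_integral_sq (hsub x)]
    simp
  simp only [e1]
  exact ofReal_integral_eq_lintegral_ofReal (integrable_integral_sub_sq hf2)
    (Eventually.of_forall fun x => integral_nonneg fun y => sq_nonneg _)

lemma gradient_apply {f : E d → ℝ} (x : E d) (i : Fin d) :
    gradient f x i = fderiv ℝ f x (EuclideanSpace.single i 1) := by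
  rw [← inner_gradient_eq_fderiv, EuclideanSpace.inner_single_left]
  simp

lemma norm_sq_eq_sum (x : E d) : ‖x‖ ^ 2 = ∑ i, x i * x i := by
  rw [EuclideanSpace.norm_sq_eq]
  refine Finset.sum_congr rfl fun i _ => ?_
  rw [Real.norm_eq_abs, sq_abs, sq]

/-- The Poincaré inequality on a ball for functions with a locally square integrable weak
gradient. -/
lemma ball_poincare {f : E d → ℝ} {G : E d → E d} (h : HasWeakGradient f G)
    (hfl : LocallyIntegrable f volume) (hf : LocL2 f) (hG : ∀ i, LocL2 fun x => G x i)
    {R : ℝ} (hR : 0 < R) :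
    2 * volume.real (Metric.closedBall (0 : E d) R) * (∫ x in Metric.closedBall (0 : E d) R, f x * f x)
        - 2 * (∫ x in Metric.closedBall (0 : E d) R, f x) ^ 2
      ≤ (2 * R) ^ 2 * (2 ^ d * volume.real (Metric.closedBall (0 : E d) R) *
        ∫ x in Metric.closedBall (0 : E d) R, ‖G x‖ ^ 2) := by
  have hlim : ∀ {a : E d → ℝ}, LocallyIntegrable a volume → LocL2 a →
      Tendsto (fun k => ∫ x in Metric.closedBall (0 : E d) R, mollify k a x * mollify k a x) atTop
        (𝓝 (∫ x in Metric.closedBall (0 : E d) R, a x * a x)) := fun hal ha =>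
    tendsto_integral_mul_of_tendsto_eLpNorm (fun k => locL2_mollify hal k R)
      (fun k => locL2_mollify hal k R) (ha R) (ha R) (tendsto_eLpNorm_mollify_restrict ha R)
      (tendsto_eLpNorm_mollify_restrict ha R)
  have hone : MemLp (fun _ : E d => (1 : ℝ)) 2 (volume.restrict (Metric.closedBall (0 : E d) R)) :=
    memLp_const 1
  have hlim1 : Tendsto (fun k => ∫ x in Metric.closedBall (0 : E d) R, mollify k f x) atTop
      (𝓝 (∫ x in Metric.closedBall (0 : E d) R, f x)) := by
    have := tendsto_integral_mul_of_tendsto_eLpNorm (fun k => locL2_mollify hfl k R)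
      (fun _ => hone) (hf R) hone (tendsto_eLpNorm_mollify_restrict hf R) (by simp)
    simpa using this
  have hGl : ∀ i, LocallyIntegrable (fun x => G x i) volume := fun i =>
    locallyIntegrableOn_univ.1 (h i).2.1
  have hlim2 : Tendsto (fun k => ∫ x in Metric.closedBall (0 : E d) R,
      ‖gradient (mollify k f) x‖ ^ 2) atTop (𝓝 (∫ x in Metric.closedBall (0 : E d) R, ‖G x‖ ^ 2)) := by
    have e1 : ∀ k x, ‖gradient (mollify k f) x‖ ^ 2
        = ∑ i, mollify k (fun x => G x i) x * mollify k (fun x => G x i) x := by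
      intro k x
      rw [norm_sq_eq_sum]
      simp only [gradient_apply, fderiv_mollify k (h _)]
    simp only [e1, norm_sq_eq_sum]
    have e2 : ∀ k, ∫ x in Metric.closedBall (0 : E d) R,
        ∑ i, mollify k (fun x => G x i) x * mollify k (fun x => G x i) x
        = ∑ i, ∫ x in Metric.closedBall (0 : E d) R,
          mollify k (fun x => G x i) x * mollify k (fun x => G x i) x := fun k =>
      integral_finsetSum _ fun i _ =>
        (locL2_mollify (hGl i) k R).integrable_mul (locL2_mollify (hGl i) k R)
    simp only [e2]
    have e3 : ∫ x in Metric.closedBall (0 : E d) R, ∑ i, G x i * G x i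
        = ∑ i, ∫ x in Metric.closedBall (0 : E d) R, G x i * G x i :=
      integral_finsetSum _ fun i _ => (hG i R).integrable_mul (hG i R)
    rw [e3]
    exact tendsto_finsetSum _ fun i _ => hlim (hGl i) (hG i)
  refine le_of_tendsto_of_tendsto' (((hlim hfl hf).const_mul _).sub ((hlim1.pow 2).const_mul 2))
    ((hlim2.const_mul _).const_mul _) fun k => ?_
  exact ball_poincare_smooth ((contDiff_mollify k hfl).of_le (by exact_mod_cast le_top)) hR

/-! ### Poincaré inequality for a Gibbs measure with drift at infinity -/

lemma HasWeakGradient.ae_eq {f : E d → ℝ} {G G' : E d → E d} (h : HasWeakGradient f G)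
    (h' : HasWeakGradient f G') : G =ᵐ[volume] G' := by
  have h1 : ∀ i : Fin d, ∀ᵐ x, G x i = G' x i := by
    intro i
    refine ae_eq_of_integral_contDiff_smul_eq (locallyIntegrableOn_univ.1 (h i).2.1)
      (locallyIntegrableOn_univ.1 (h' i).2.1) fun ψ hψ hc => ?_
    have e1 := (h i).2.2 ψ hψ hc (subset_univ _)
    have e2 := (h' i).2.2 ψ hψ hc (subset_univ _)
    rw [e1] at e2
    simpa [mul_comm] using neg_inj.1 e2
  filter_upwards [ae_all_iff.2 h1] with x hx
  ext i
  exact hx i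

lemma HasWeakGradient.sub_const {f : E d → ℝ} {G : E d → E d} (h : HasWeakGradient f G) (c : ℝ) :
    HasWeakGradient (fun x => f x - c) G := by
  intro i
  have hfl : LocallyIntegrable f volume := locallyIntegrableOn_univ.1 (h i).1
  refine ⟨locallyIntegrableOn_univ.2 (hfl.sub (locallyIntegrable_const c)), (h i).2.1,
    fun ψ hψ hc hs => ?_⟩
  have e1 := (h i).2.2 ψ hψ hc hs
  simp only [Measure.restrict_univ] at e1 ⊢
  set v : E d := EuclideanSpace.single i 1
  have hψ' : Continuous fun x => fderiv ℝ ψ x v :=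
    (hψ.continuous_fderiv (by simp)).clm_apply continuous_const
  have hc' : HasCompactSupport fun x => fderiv ℝ ψ x v := hc.fderiv_apply ℝ v
  have i1 : Integrable (fun x => f x * fderiv ℝ ψ x v) volume := by
    simpa [mul_comm] using hfl.integrable_smul_left_of_hasCompactSupport hψ' hc'
  have i2 : Integrable (fun x => c * fderiv ℝ ψ x v) volume :=
    (hψ'.integrable_of_hasCompactSupport hc').const_mul c
  have e2 := integral_mul_fderiv_eq_neg_fderiv_mul_of_integrable (μ := (volume : Measure (E d)))
    (f := fun _ => c) (g := ψ) (v := v) (by simp) i2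
    ((hψ.continuous.integrable_of_hasCompactSupport hc).const_mul c)
    (fun x _ => differentiableAt_const c) (fun x _ => hψ.differentiable (by simp) x)
  simp only [fderiv_fun_const, Pi.zero_apply, _root_.zero_apply, zero_mul,
    integral_zero, neg_zero] at e2
  simp only [sub_mul]
  rw [integral_sub i1 i2, e1, e2, sub_zero]

/-! ### Comparison of `e^{-V} dx` with Lebesgue measure on balls. -/

/-- The measure with Lebesgue density `e^{-V}`. -/
def gibbs (V : E d → ℝ) : Measure (E d) :=
  volume.withDensity fun x => ENNReal.ofReal (Real.exp (-V x))

lemma gibbs_absolutelyContinuous (V : E d → ℝ) : gibbs V ≪ volume :=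
  withDensity_absolutelyContinuous _ _

/-- On the ball `1 ≤ e^M e^{-V}`. This is what turns `L²` for the Gibbs measure into local `L²` for
Lebesgue measure. -/
lemma restrict_le_smul_gibbs (V : E d → ℝ) {r M : ℝ}
    (hM : ∀ x ∈ Metric.closedBall (0 : E d) r, V x ≤ M) :
    volume.restrict (Metric.closedBall (0 : E d) r) ≤ ENNReal.ofReal (Real.exp M) • gibbs V := by
  refine Measure.le_iff.2 fun s hs => ?_
  rw [Measure.restrict_apply hs, Measure.smul_apply, smul_eq_mul, gibbs, withDensity_apply _ hs,
    ← lintegral_const_mul' _ _ ENNReal.ofReal_ne_top]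
  calc volume (s ∩ Metric.closedBall (0 : E d) r)
      = ∫⁻ _ in s ∩ Metric.closedBall (0 : E d) r, 1 := by simp
    _ ≤ ∫⁻ x in s ∩ Metric.closedBall (0 : E d) r,
          ENNReal.ofReal (Real.exp M) * ENNReal.ofReal (Real.exp (-V x)) := by
        refine setLIntegral_mono' (hs.inter measurableSet_closedBall) fun x hx => ?_
        rw [← ENNReal.ofReal_mul (Real.exp_pos _).le, ← Real.exp_add, ← ENNReal.ofReal_one]
        exact ENNReal.ofReal_le_ofReal (Real.one_le_exp (by linarith [hM x hx.2]))
    _ ≤ _ := lintegral_mono_set inter_subset_left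

lemma memLp_restrict_of_gibbs {V : E d → ℝ} (hV : Continuous V) {F : Type*} [NormedAddCommGroup F]
    {f : E d → F} (hf : MemLp f 2 (gibbs V)) (r : ℝ) :
    MemLp f 2 (volume.restrict (Metric.closedBall (0 : E d) r)) := by
  obtain ⟨M, hM⟩ := (isCompact_closedBall (0 : E d) r).exists_bound_of_continuousOn hV.continuousOn
  exact hf.of_measure_le_smul ENNReal.ofReal_ne_top
    (restrict_le_smul_gibbs V fun x hx => (le_abs_self _).trans (hM x hx))

lemma integral_gibbs {V : E d → ℝ} (hV : Continuous V) (f : E d → ℝ) :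
    ∫ x, f x ∂(gibbs V) = ∫ x, f x * Real.exp (-V x) := by
  rw [gibbs, integral_withDensity_eq_integral_toReal_smul (by fun_prop)
    (Eventually.of_forall fun _ => ENNReal.ofReal_lt_top)]
  refine integral_congr_ae (Eventually.of_forall fun x => ?_)
  simp [ENNReal.toReal_ofReal (Real.exp_pos _).le, mul_comm]

lemma integrable_gibbs {V : E d → ℝ} (hV : Continuous V) {f : E d → ℝ}
    (hf : Integrable f (gibbs V)) : Integrable (fun x => f x * Real.exp (-V x)) volume := by
  rw [gibbs, integrable_withDensity_iff (by fun_prop)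
    (Eventually.of_forall fun _ => ENNReal.ofReal_lt_top)] at hf
  simpa [ENNReal.toReal_ofReal (Real.exp_pos _).le] using hf

lemma measureReal_closedBall_pos {R : ℝ} (hR : 0 < R) :
    0 < volume.real (Metric.closedBall (0 : E d) R) :=
  ENNReal.toReal_pos (Metric.measure_closedBall_pos volume _ hR).ne' measure_closedBall_lt_top.ne

/-- The constant in the Poincaré inequality. -/
def poincareConst (d : ℕ) (η R g M : ℝ) : ℝ :=
  64 / η ^ 2 * (1 + (η ^ 2 / 64 + (η / 8 * g + η / 8 * d / R + (η / 8) ^ 2)) *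
    (2 ^ (d + 1) * R ^ 2 * Real.exp (2 * M)))

/-- Lyapunov drift at infinity and the local inequality on a ball imply a Poincaré inequality. -/
lemma poincareWith_gibbs (hd : 0 < d) {V : E d → ℝ} (hV : ContDiff ℝ 1 V) [IsProbabilityMeasure (gibbs V)]
    {η R g M : ℝ} (hη : 0 < η) (hR : 0 < R) (hdR : 2 * d / η ≤ R)
    (hdrift : ∀ x, R ≤ ‖x‖ → η * ‖x‖ ≤ inner ℝ x (gradient V x)) (hg0 : 0 ≤ g)
    (hg : ∀ x ∈ Metric.closedBall (0 : E d) R, ‖gradient V x‖ ≤ g)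
    (hM : ∀ x ∈ Metric.closedBall (0 : E d) R, |V x| ≤ M) :
    PoincareWith (gibbs V) (poincareConst d η R g M) := by
  rintro f ⟨⟨hf2, G', hG', hG'2⟩, hmean⟩ G hG
  have hVc := hV.continuous
  have hG2 : MemLp G 2 (gibbs V) :=
    hG'2.ae_eq ((gibbs_absolutelyContinuous V).ae_eq (hG'.ae_eq hG))
  have hGloc := memLp_restrict_of_gibbs hVc hG2
  have hGi : ∀ i, LocL2 fun x => G x i := fun i r =>
    (hGloc r).of_le ((EuclideanSpace.proj (𝕜 := ℝ) i).continuous.comp_aestronglyMeasurable (hGloc r).1)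
       (Eventually.of_forall fun x => PiLp.norm_apply_le (G x) i)
  have hfloc : LocL2 f := memLp_restrict_of_gibbs hVc hf2
  set B := Metric.closedBall (0 : E d) R with hB
  set m := volume.real B with hm
  have hmpos : 0 < m := measureReal_closedBall_pos hR
  -- The mean over the ball for Lebesgue measure, as the local inequality requires, not the mean for
  -- the Gibbs measure.
  set c := (∫ x in B, f x) / m with hc
  set F : E d → ℝ := fun x => f x - c with hF
  have hFG : HasWeakGradient F G := hG.sub_const c
  have hF2 : MemLp F 2 (gibbs V) := hf2.sub (memLp_const c)
  have hFloc : LocL2 F := memLp_restrict_of_gibbs hVc hF2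
  have hFi : Integrable (fun x => F x * F x * Real.exp (-V x)) volume :=
    integrable_gibbs hVc (f := fun x => F x * F x) (hF2.integrable_mul hF2)
  have hGint : Integrable (fun x => ‖G x‖ ^ 2 * Real.exp (-V x)) volume :=
    integrable_gibbs hVc hG2.norm.integrable_sq
  have hlyap := lyapunov_inequality hV hFG hFloc hGi hFi hGint hη hR hdR hdrift hg0 hg
  -- the local inequality
  have hloc : ∫ x in B, F x * F x ≤ 2 ^ (d + 1) * R ^ 2 * ∫ x in B, ‖G x‖ ^ 2 := by
    -- Local integrability of `f` is read off from one component of the weak gradient, hence `0 <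
    -- d`.
    have hfl : LocallyIntegrable f volume := locallyIntegrableOn_univ.1 (hG ⟨0, hd⟩).1
    have h1 := ball_poincare hG hfl hfloc hGi hR
    have h2 : ∫ x in B, F x * F x = (∫ x in B, f x * f x) - (∫ x in B, f x) ^ 2 / m := by
      have h3 := integral_sub_sq (hfloc R) c
      have h4 : ∀ x, F x * F x = (c - f x) ^ 2 := fun x => by simp only [hF]; ring
      simp only [h4]
      rw [h3, measureReal_restrict_apply_univ, ← hB, ← hm, hc]
      field_simp
      ring
    rw [h2]
    refine le_of_mul_le_mul_left ?_ (by positivity : 0 < 2 * m)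
    calc 2 * m * ((∫ x in B, f x * f x) - (∫ x in B, f x) ^ 2 / m)
        = 2 * m * (∫ x in B, f x * f x) - 2 * (∫ x in B, f x) ^ 2 := by field_simp
      _ ≤ _ := h1
      _ = _ := by ring
  -- transfer to the weighted measure
  have hFB : IntegrableOn (fun x => F x * F x) B volume := (hFloc R).integrable_mul (hFloc R)
  have hGB : IntegrableOn (fun x => ‖G x‖ ^ 2) B volume := (hGloc R).norm.integrable_sq
  have h5 : ∫ x in B, F x * F x * Real.exp (-V x) ≤ Real.exp M * ∫ x in B, F x * F x := by
    rw [← integral_const_mul]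
    refine setIntegral_mono_on hFi.integrableOn (hFB.const_mul _) measurableSet_closedBall
      fun x hx => ?_
    rw [mul_comm]
    refine mul_le_mul_of_nonneg_right (Real.exp_le_exp.2 ?_) (mul_self_nonneg _)
    exact (neg_le_abs _).trans (hM x hx)
  have h6 : ∫ x in B, ‖G x‖ ^ 2 ≤ Real.exp M * ∫ x, ‖G x‖ ^ 2 * Real.exp (-V x) := by
    calc ∫ x in B, ‖G x‖ ^ 2 ≤ ∫ x in B, Real.exp M * (‖G x‖ ^ 2 * Real.exp (-V x)) := by
          refine setIntegral_mono_on hGB (hGint.integrableOn.const_mul _) measurableSet_closedBall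
            fun x hx => ?_
          have : 1 ≤ Real.exp M * Real.exp (-V x) := by
            rw [← Real.exp_add]
            exact Real.one_le_exp (by linarith [(le_abs_self _).trans (hM x hx)])
          nlinarith [sq_nonneg ‖G x‖]
      _ = Real.exp M * ∫ x in B, ‖G x‖ ^ 2 * Real.exp (-V x) := integral_const_mul _ _
      _ ≤ _ := by
          gcongr ?_ * ?_
          exact setIntegral_le_integral hGint (Eventually.of_forall fun x => by positivity)
  -- Since `f` has mean zero, `∫ (f - c)² = ∫ f² + c²`.
  have h7 : ∫ x, f x ^ 2 ∂(gibbs V) ≤ ∫ x, F x * F x * Real.exp (-V x) := by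
    rw [← integral_gibbs hVc (fun x => F x * F x)]
    have h3 := integral_sub_sq hf2 c
    have h4 : ∀ x, F x * F x = (c - f x) ^ 2 := fun x => by simp only [hF]; ring
    simp only [h4]
    rw [h3, hmean]
    simp only [sq, measureReal_def, measure_univ, ENNReal.toReal_one]
    nlinarith [mul_self_nonneg c]
  rw [integral_gibbs hVc (fun x => ‖G x‖ ^ 2)]
  set J := ∫ x, ‖G x‖ ^ 2 * Real.exp (-V x) with hJ
  set b := η ^ 2 / 64 + (η / 8 * g + η / 8 * d / R + (η / 8) ^ 2) with hb
  have hb0 : 0 ≤ b := by positivity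
  have h8 : ∫ x in B, F x * F x * Real.exp (-V x) ≤ 2 ^ (d + 1) * R ^ 2 * Real.exp (2 * M) * J := by
    calc _ ≤ Real.exp M * ∫ x in B, F x * F x := h5
      _ ≤ Real.exp M * (2 ^ (d + 1) * R ^ 2 * (Real.exp M * J)) := by
          gcongr
          exact hloc.trans (by gcongr)
      _ = _ := by rw [two_mul M, Real.exp_add]; ring
  refine h7.trans ?_
  have h9 : η ^ 2 / 64 * ∫ x, F x * F x * Real.exp (-V x)
      ≤ (1 + b * (2 ^ (d + 1) * R ^ 2 * Real.exp (2 * M))) * J := by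
    refine hlyap.trans ?_
    have := mul_le_mul_of_nonneg_left h8 hb0
    linarith
  have h10 : (0 : ℝ) < 64 / η ^ 2 := by positivity
  have h11 := mul_le_mul_of_nonneg_left h9 h10.le
  rw [poincareConst, ← hb, mul_assoc]
  refine le_trans (le_of_eq ?_) h11
  field_simp

/-! ### The space-time measure of a curve of densities -/

/-- Joint measurability of the densities makes `t ↦ δ_t ⊗ μ_t` a measurable kernel. With a density
for the product measure, Tonelli and almost-everywhere slicing become available. -/
lemma spaceTime_eq_withDensity {μ : ℝ → Measure (E d)} {ρ : ℝ × E d → ENNReal}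
    (hρ : Measurable ρ) (hμ : ∀ t, μ t = volume.withDensity fun x => ρ (t, x)) :
    spaceTime μ = ((volume.restrict (Icc (0 : ℝ) 1)).prod volume).withDensity ρ := by
  have hval : ∀ t : ℝ, ∀ s : Set (ℝ × E d), MeasurableSet s →
      ((μ t).map (Prod.mk t)) s = ∫⁻ x, s.indicator ρ (t, x) := by
    intro t s hs
    rw [Measure.map_apply measurable_prodMk_left hs, hμ,
      withDensity_apply _ (measurable_prodMk_left hs),
      ← lintegral_indicator (measurable_prodMk_left hs)]
    rfl
  have hmeas : Measurable fun t : ℝ => (μ t).map (Prod.mk t) := by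
    refine Measure.measurable_of_measurable_coe _ fun s hs => ?_
    simp only [hval _ s hs]
    exact (hρ.indicator hs).lintegral_prod_right'
  ext s hs
  rw [spaceTime, Measure.bind_apply hs hmeas.aemeasurable, withDensity_apply _ hs,
    ← lintegral_indicator hs, lintegral_prod _ (hρ.indicator hs).aemeasurable]
  exact lintegral_congr fun t => hval t s hs

lemma isDisintegration_spaceTime {μ : ℝ → Measure (E d)} {ρ : ℝ × E d → ENNReal}
    (hρ : Measurable ρ) (hμ : ∀ t, μ t = volume.withDensity fun x => ρ (t, x)) :
    IsDisintegration μ (spaceTime μ) := by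
  intro f hf
  rw [spaceTime_eq_withDensity hρ hμ, lintegral_withDensity_eq_lintegral_mul _ hρ hf,
    lintegral_prod _ (hρ.mul hf).aemeasurable]
  refine lintegral_congr fun t => ?_
  have h1 : Measurable fun x => ρ (t, x) := hρ.comp measurable_prodMk_left
  have h2 : Measurable fun x => f (t, x) := hf.comp measurable_prodMk_left
  rw [hμ, lintegral_withDensity_eq_lintegral_mul _ h1 h2]
  rfl

lemma ae_ae_of_ae_spaceTime {μ : ℝ → Measure (E d)} {ρ : ℝ × E d → ENNReal}
    (hρ : Measurable ρ) (hμ : ∀ t, μ t = volume.withDensity fun x => ρ (t, x))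
    {P : ℝ × E d → Prop} (hP : ∀ᵐ p ∂(spaceTime μ), P p) :
    ∀ᵐ t ∂(volume.restrict (Icc (0 : ℝ) 1)), ∀ᵐ x ∂(μ t), P (t, x) := by
  rw [spaceTime_eq_withDensity hρ hμ, ae_withDensity_iff hρ] at hP
  filter_upwards [Measure.ae_ae_of_ae_prod hP] with t ht
  have h1 : Measurable fun x => ρ (t, x) := hρ.comp measurable_prodMk_left
  rw [hμ, ae_withDensity_iff h1]
  exact ht

lemma lintegral_spaceTime {μ : ℝ → Measure (E d)} {ρ : ℝ × E d → ENNReal}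
    (hρ : Measurable ρ) (hμ : ∀ t, μ t = volume.withDensity fun x => ρ (t, x))
    {f : ℝ × E d → ENNReal} (hf : AEMeasurable f (spaceTime μ)) :
    ∫⁻ p, f p ∂(spaceTime μ) = ∫⁻ t in Icc (0 : ℝ) 1, ∫⁻ x, f (t, x) ∂(μ t) := by
  rw [lintegral_congr_ae hf.ae_eq_mk, isDisintegration_spaceTime hρ hμ _ hf.measurable_mk]
  refine lintegral_congr_ae ?_
  filter_upwards [ae_ae_of_ae_spaceTime hρ hμ hf.ae_eq_mk] with t ht
  exact (lintegral_congr_ae ht).symm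

/-! ### Slices of weak spatial gradients -/

/-- The open slab `(0,1) × ℝ^d`. -/
def slab (d : ℕ) : Set (ℝ × E d) := Ioo (0 : ℝ) 1 ×ˢ univ

lemma isOpen_slab : IsOpen (slab d) := isOpen_Ioo.prod isOpen_univ

/-- Weak spatial gradients are determined on the open slab only; the two end times are null for the
space-time measure. -/
lemma ae_spaceTime_of_ae_slab {μ : ℝ → Measure (E d)} {ρ : ℝ × E d → ENNReal}
    (hρ : Measurable ρ) (hμ : ∀ t, μ t = volume.withDensity fun x => ρ (t, x))
    {P : ℝ × E d → Prop} (hP : ∀ᵐ p : ℝ × E d, p ∈ slab d → P p) :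
    ∀ᵐ p ∂(spaceTime μ), P p := by
  rw [spaceTime_eq_withDensity hρ hμ]
  refine (withDensity_absolutelyContinuous _ _).ae_le ?_
  rw [← ae_restrict_iff' isOpen_slab.measurableSet, slab, Measure.volume_eq_prod,
    ← Measure.prod_restrict, Measure.restrict_univ] at hP
  rwa [← Measure.restrict_congr_set Ioo_ae_eq_Icc]

lemma integrable_mul_of_locallyIntegrableOn {X : Type*} [MetricSpace X] [MeasurableSpace X]
    [BorelSpace X] [SecondCountableTopology X] {ν : Measure X} {a w : X → ℝ} {U : Set X}
    (ha : LocallyIntegrableOn a U ν) (hw : Continuous w) (hc : HasCompactSupport w)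
    (hs : tsupport w ⊆ U) : Integrable (fun x => a x * w x) ν := by
  obtain ⟨M, hM⟩ := hc.exists_bound_of_continuous hw
  have h1 : IntegrableOn (fun x => a x * w x) (tsupport w) ν :=
    (ha.integrableOn_compact_subset hs hc.isCompact).mul_bdd (c := M) hw.aestronglyMeasurable
      (Eventually.of_forall hM)
  refine (integrableOn_iff_integrable_of_support_subset fun x hx => ?_).1 h1
  by_contra h
  exact hx (by simp [image_eq_zero_of_notMem_tsupport h])

lemma HasWeakSpatialGradient.ae_eq {s : ℝ × E d → ℝ} {G G' : ℝ × E d → E d}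
    (h : HasWeakSpatialGradient s G) (h' : HasWeakSpatialGradient s G') :
    ∀ᵐ p : ℝ × E d, p ∈ slab d → G p = G' p := by
  have h1 : ∀ i : Fin d, ∀ᵐ p : ℝ × E d, p ∈ slab d → G p i - G' p i = 0 := by
    intro i
    refine isOpen_slab.ae_eq_zero_of_integral_contDiff_smul_eq_zero
      ((h i).2.1.sub (h' i).2.1) fun ψ hψ hc hs => ?_
    have e1 := (h i).2.2 ψ hψ hc hs
    have e2 := (h' i).2.2 ψ hψ hc hs
    rw [e1, neg_inj] at e2
    have hz : ∀ a : ℝ × E d → ℝ, ∫ z in Ioo (0 : ℝ) 1 ×ˢ univ, a z * ψ z = ∫ z, ψ z * a z := by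
      intro a
      rw [setIntegral_eq_integral_of_forall_compl_eq_zero]
      · simp [mul_comm]
      · intro x hx
        rw [image_eq_zero_of_notMem_tsupport fun hx' => hx (hs hx'), mul_zero]
    rw [hz, hz] at e2
    have hint : ∀ {a : ℝ × E d → ℝ}, LocallyIntegrableOn a (slab d) volume →
        Integrable (fun z => ψ z * a z) volume := fun ha =>
      by simpa only [mul_comm] using integrable_mul_of_locallyIntegrableOn ha hψ.continuous hc hs
    simp only [smul_eq_mul, mul_sub]
    rw [integral_sub (hint (h i).2.1) (hint (h' i).2.1), e2, sub_self]
  filter_upwards [ae_all_iff.2 h1] with p hp hps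
  ext i
  exact sub_eq_zero.1 (hp i hps)

/-- Fubini on the compact boxes `[1/(n+1), 1 - 1/(n+1)] × B(n)`, which exhaust the slab; countably
many exceptional sets of times are discarded. -/
lemma ae_locallyIntegrable_slice {a : ℝ × E d → ℝ} (ha : LocallyIntegrableOn a (slab d) volume) :
    ∀ᵐ t : ℝ, t ∈ Ioo (0 : ℝ) 1 → LocallyIntegrable (fun x => a (t, x)) volume := by
  have h1 : ∀ n : ℕ, ∀ᵐ t : ℝ, t ∈ Icc (1 / ((n : ℝ) + 1)) (1 - 1 / ((n : ℝ) + 1)) →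
      IntegrableOn (fun x => a (t, x)) (Metric.closedBall (0 : E d) n) volume := by
    intro n
    have hpos : (0 : ℝ) < 1 / ((n : ℝ) + 1) := by positivity
    have hK := ha.integrableOn_compact_subset (t := Icc (1 / ((n : ℝ) + 1)) (1 - 1 / ((n : ℝ) + 1))
      ×ˢ Metric.closedBall (0 : E d) n) (fun p hp => ⟨⟨hpos.trans_le hp.1.1, by linarith [hp.1.2]⟩,
        mem_univ _⟩) (isCompact_Icc.prod (isCompact_closedBall _ _))
    rw [IntegrableOn, Measure.volume_eq_prod, ← Measure.prod_restrict] at hK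
    exact (ae_restrict_iff' measurableSet_Icc).1 hK.prod_right_ae
  filter_upwards [ae_all_iff.2 h1] with t ht ht01
  rw [locallyIntegrable_iff]
  intro k hk
  obtain ⟨r, hr⟩ := hk.isBounded.subset_closedBall (0 : E d)
  have hlim := tendsto_one_div_add_atTop_nhds_zero_nat (𝕜 := ℝ)
  obtain ⟨n, h2, h3, h4⟩ := ((hlim.eventually_lt_const ht01.1).and
    ((hlim.eventually_lt_const (sub_pos.2 ht01.2)).and
      (tendsto_natCast_atTop_atTop.eventually_ge_atTop r))).exists
  exact (ht n ⟨h2.le, by linarith⟩).mono_set (hr.trans (Metric.closedBall_subset_closedBall h4))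

/-- Test with products `θ(t) ψ(x)`, apply Fubini, and use the fundamental lemma in `t`. The
exceptional set of times depends on `ψ`. -/
lemma ae_integral_slice_eq_zero {s g : ℝ × E d → ℝ} {v : E d}
    (h : HasWeakDerivOn (slab d) ((0 : ℝ), v) s g) {ψ : E d → ℝ} (hψ : ContDiff ℝ ∞ ψ)
    (hc : HasCompactSupport ψ) :
    ∀ᵐ t : ℝ, t ∈ Ioo (0 : ℝ) 1 → ∫ x, (s (t, x) * fderiv ℝ ψ x v + g (t, x) * ψ x) = 0 := by
  have hψ' : Continuous fun x => fderiv ℝ ψ x v :=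
    (hψ.continuous_fderiv (by simp)).clm_apply continuous_const
  have hc' : HasCompactSupport fun x => fderiv ℝ ψ x v := hc.fderiv_apply ℝ v
  have hprod : ∀ {a : ℝ × E d → ℝ} {θ : ℝ → ℝ} {w : E d → ℝ}, LocallyIntegrableOn a (slab d) volume →
      Continuous θ → HasCompactSupport θ → tsupport θ ⊆ Ioo 0 1 → Continuous w →
      HasCompactSupport w → Integrable (fun p : ℝ × E d => a p * (θ p.1 * w p.2)) volume := by
    intro a θ w ha hθ hθc hθs hw hwc
    have hsub : tsupport (fun p : ℝ × E d => θ p.1 * w p.2) ⊆ tsupport θ ×ˢ tsupport w := by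
      refine closure_minimal (fun p hp => ?_) ((isClosed_tsupport θ).prod (isClosed_tsupport w))
      exact ⟨subset_tsupport θ (left_ne_zero_of_mul hp), subset_tsupport w (right_ne_zero_of_mul hp)⟩
    refine integrable_mul_of_locallyIntegrableOn ha (by fun_prop)
      ((hθc.isCompact.prod hwc.isCompact).of_isClosed_subset (isClosed_tsupport _) hsub)
      (hsub.trans fun p hp => ⟨hθs hp.1, mem_univ _⟩)
  have hk : ∀ {θ : ℝ → ℝ}, Continuous θ → HasCompactSupport θ → tsupport θ ⊆ Ioo 0 1 →
      Integrable (fun p : ℝ × E d => θ p.1 * (s p * fderiv ℝ ψ p.2 v + g p * ψ p.2))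
        (volume.prod volume) := by
    intro θ hθ hθc hθs
    refine ((hprod h.1 hθ hθc hθs hψ' hc').add
      (hprod h.2.1 hθ hθc hθs hψ.continuous hc)).congr (Eventually.of_forall fun p => ?_)
    simp only [Pi.add_apply]
    ring
  refine isOpen_Ioo.ae_eq_zero_of_integral_contDiff_smul_eq_zero ?_ fun θ hθ hθc hθs => ?_
  · rw [locallyIntegrableOn_iff isOpen_Ioo.isLocallyClosed]
    intro K hK hKc
    -- A time cutoff equal to 1 on `K` gives local integrability in `t` of the slice integral.
    obtain ⟨θ, hθ1, hθ2, hθ3, hθ4⟩ : ∃ θ : ℝ → ℝ, Continuous θ ∧ HasCompactSupport θ ∧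
        tsupport θ ⊆ Ioo 0 1 ∧ ∀ t ∈ K, θ t = 1 := by
      obtain ⟨θ, h1, h2, h3, -⟩ := 
        exists_continuousMap_one_of_isCompact_subset_isOpen hKc isOpen_Ioo hK
      exact ⟨θ, θ.continuous, h2, h3, fun t ht => h1 ht⟩
    have h1 := (hk hθ1 hθ2 hθ3).integral_prod_left
    refine (h1.integrableOn (s := K)).congr_fun (fun t ht => ?_) hKc.measurableSet
    simp [hθ4 t ht]
  · have hw : ContDiff ℝ ∞ fun p : ℝ × E d => θ p.1 * ψ p.2 :=
      (hθ.comp contDiff_fst).mul (hψ.comp contDiff_snd)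
    have hsub : tsupport (fun p : ℝ × E d => θ p.1 * ψ p.2) ⊆ tsupport θ ×ˢ tsupport ψ := by
      refine closure_minimal (fun p hp => ?_) ((isClosed_tsupport θ).prod (isClosed_tsupport ψ))
      exact ⟨subset_tsupport θ (left_ne_zero_of_mul hp), subset_tsupport ψ (right_ne_zero_of_mul hp)⟩
    have hcs : HasCompactSupport fun p : ℝ × E d => θ p.1 * ψ p.2 :=
      (hθc.isCompact.prod hc.isCompact).of_isClosed_subset (isClosed_tsupport _) hsub
    have hsl : tsupport (fun p : ℝ × E d => θ p.1 * ψ p.2) ⊆ slab d :=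
      hsub.trans fun p hp => ⟨hθs hp.1, mem_univ _⟩
    have key := h.2.2 _ hw hcs hsl
    have hder : ∀ p : ℝ × E d, fderiv ℝ (fun p : ℝ × E d => θ p.1 * ψ p.2) p ((0 : ℝ), v)
        = θ p.1 * fderiv ℝ ψ p.2 v := by
      intro p
      have d1 : HasFDerivAt (fun p : ℝ × E d => θ p.1) _ p :=
        ((hθ.differentiable (by simp) p.1).hasFDerivAt).comp p hasFDerivAt_fst
      have d2 : HasFDerivAt (fun p : ℝ × E d => ψ p.2) _ p :=
        ((hψ.differentiable (by simp) p.2).hasFDerivAt).comp p hasFDerivAt_snd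
      rw [(d1.fun_mul d2).fderiv]
      simp
    simp only [hder] at key
    rw [setIntegral_eq_integral_of_forall_compl_eq_zero, setIntegral_eq_integral_of_forall_compl_eq_zero,
      eq_neg_iff_add_eq_zero, ← integral_add (hprod h.1 hθ.continuous hθc hθs hψ' hc')
      (hprod h.2.1 hθ.continuous hθc hθs hψ.continuous hc)] at key
    · have e1 : ∀ t : ℝ, θ t • ∫ x, (s (t, x) * fderiv ℝ ψ x v + g (t, x) * ψ x)
          = ∫ x, θ t * (s (t, x) * fderiv ℝ ψ x v + g (t, x) * ψ x) := fun t => by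
        rw [smul_eq_mul, integral_const_mul]
      simp only [e1]
      rw [← integral_prod (fun p : ℝ × E d => θ p.1 * (s p * fderiv ℝ ψ p.2 v + g p * ψ p.2))
        (hk hθ.continuous hθc hθs), ← key, Measure.volume_eq_prod]
      refine integral_congr_ae (Eventually.of_forall fun p => ?_)
      simp only
      ring
    · intro p hp
      rw [image_eq_zero_of_notMem_tsupport fun hp' => hp (hsl hp'), mul_zero]
    · intro p hp
      have : θ p.1 = 0 := image_eq_zero_of_notMem_tsupport fun hp' => hp ⟨hθs hp', mem_univ _⟩
      rw [this, zero_mul, mul_zero]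

/-- Almost every slice of a weak spatial gradient agrees with any weak gradient of the slice. -/
lemma HasWeakSpatialGradient.ae_slice_eq {s : ℝ × E d → ℝ} {G : ℝ × E d → E d}
    (h : HasWeakSpatialGradient s G) :
    ∀ᵐ t : ℝ, t ∈ Ioo (0 : ℝ) 1 → ∀ H : E d → E d, HasWeakGradient (fun x => s (t, x)) H →
      H =ᵐ[volume] fun x => G (t, x) := by
  have h1 : ∀ i : Fin d, ∀ᵐ t : ℝ, t ∈ Ioo (0 : ℝ) 1 →
      LocallyIntegrable (fun x => G (t, x) i) volume := fun i =>
    ae_locallyIntegrable_slice (h i).2.1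
  -- Only countably many test functions are used, the mollifiers centred at a dense sequence, so one
  -- null set of times serves them all.
  have h2 : ∀ (i : Fin d) (k j : ℕ), ∀ᵐ t : ℝ, t ∈ Ioo (0 : ℝ) 1 →
      ∫ x, (s (t, x) * fderiv ℝ (fun y => mollifier d k (TopologicalSpace.denseSeq (E d) j - y)) x
        (EuclideanSpace.single i 1) + G (t, x) i *
          mollifier d k (TopologicalSpace.denseSeq (E d) j - x)) = 0 := fun i k j =>
    ae_integral_slice_eq_zero (h i) (contDiff_mollifier_sub k _) (hasCompactSupport_mollifier_sub k _)
  filter_upwards [ae_all_iff.2 h1, ae_all_iff.2 fun i => ae_all_iff.2 fun k => ae_all_iff.2 (h2 i k)]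
    with t ht1 ht2 ht H hH
  have h3 : ∀ i : Fin d, ∀ᵐ x, H x i = G (t, x) i := by
    intro i
    have hHl : LocallyIntegrable (fun x => H x i) volume := locallyIntegrableOn_univ.1 (hH i).2.1
    have hsl : LocallyIntegrable (fun x => s (t, x)) volume := locallyIntegrableOn_univ.1 (hH i).1
    have hGl := ht1 i ht
    have hdense : ∀ k j, mollify k (fun x => H x i) (TopologicalSpace.denseSeq (E d) j)
        = mollify k (fun x => G (t, x) i) (TopologicalSpace.denseSeq (E d) j) := by
      intro k j
      set q := TopologicalSpace.denseSeq (E d) j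
      have hψ := contDiff_mollifier_sub (d := d) k q
      have hc := hasCompactSupport_mollifier_sub (d := d) k q
      have e1 := (hH i).2.2 _ hψ hc (subset_univ _)
      have e2 := ht2 i k j ht
      have i1 : Integrable (fun x => s (t, x) * fderiv ℝ (fun y => mollifier d k (q - y)) x
          (EuclideanSpace.single i 1)) volume :=
        integrable_mul_of_locallyIntegrableOn (locallyIntegrableOn_univ.2 hsl)
          ((hψ.continuous_fderiv (by simp)).clm_apply continuous_const) (hc.fderiv_apply ℝ _)
          (subset_univ _)
      have i2 : Integrable (fun x => G (t, x) i * mollifier d k (q - x)) volume :=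
        integrable_mul_of_locallyIntegrableOn (locallyIntegrableOn_univ.2 hGl) hψ.continuous hc
          (subset_univ _)
      rw [integral_add i1 i2] at e2
      simp only [Measure.restrict_univ] at e1
      rw [e1, neg_add_eq_zero] at e2
      simpa only [mollify, mul_comm] using e2
    -- Mollifications are continuous, so agreement at the dense centres is agreement everywhere;
    -- letting `k → ∞` recovers the functions almost everywhere.
    have hall : ∀ k, mollify k (fun x => H x i) = mollify k (fun x => G (t, x) i) := fun k =>
      (contDiff_mollify k hHl).continuous.ext_on (TopologicalSpace.denseRange_denseSeq (E d))
        (contDiff_mollify k hGl).continuous (by rintro _ ⟨j, rfl⟩; exact hdense k j)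
    filter_upwards [ae_tendsto_mollify hHl, ae_tendsto_mollify hGl] with x hx1 hx2
    simp only [hall] at hx1
    exact tendsto_nhds_unique hx1 hx2
  filter_upwards [ae_all_iff.2 h3] with x hx
  ext i
  exact hx i

/-- A Poincaré inequality holding at every time integrates to the partial Poincaré inequality. -/
lemma partialPoincareWith_of_forall {μ : ℝ → Measure (E d)} {ρ : ℝ × E d → ENNReal}
    (hρ : Measurable ρ) (hμ : ∀ t, μ t = volume.withDensity fun x => ρ (t, x)) {K : ℝ}
    (hK : 0 ≤ K) (hP : ∀ t ∈ Icc (0 : ℝ) 1, PoincareWith (μ t) K) : PartialPoincareWith μ K := by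
  rintro s ⟨⟨hs2, G', hG', hG'2⟩, hslice⟩ G hG
  have hG2 : MemLp G 2 (spaceTime μ) :=
    hG'2.ae_eq (ae_spaceTime_of_ae_slab hρ hμ (hG'.ae_eq hG))
  have hmem : ∀ᵐ t ∂(volume.restrict (Icc (0 : ℝ) 1)), t ∈ Ioo (0 : ℝ) 1 := by
    rw [← Measure.restrict_congr_set Ioo_ae_eq_Icc]
    exact ae_restrict_mem measurableSet_Ioo
  -- With integrals in `[0, ∞]`, integrating over `t` needs no integrability of the slice energies.
  have hle : ∀ᵐ t ∂(volume.restrict (Icc (0 : ℝ) 1)),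
      ∫⁻ x, ‖s (t, x)‖ₑ ^ 2 ∂(μ t) ≤ ENNReal.ofReal K * ∫⁻ x, ‖G (t, x)‖ₑ ^ 2 ∂(μ t) := by
    filter_upwards [hslice, hmem, ae_restrict_of_ae hG.ae_slice_eq] with t ht ht01 htG
    obtain ⟨⟨ht2, H, hH, hH2⟩, -⟩ := id ht
    have hac : μ t ≪ volume := by
      rw [hμ]
      exact withDensity_absolutelyContinuous _ _
    have hHG := hac.ae_eq (htG ht01 H hH)
    have h1 := hP t (Ioo_subset_Icc_self ht01) _ ht H hH
    have h2 : ∫⁻ x, ‖G (t, x)‖ₑ ^ 2 ∂(μ t) = ∫⁻ x, ‖H x‖ₑ ^ 2 ∂(μ t) := by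
      refine lintegral_congr_ae ?_
      filter_upwards [hHG] with x hx
      rw [hx]
    rw [h2, ← ofReal_integral_sq ht2, ← ofReal_integral_sq hH2, ← ENNReal.ofReal_mul hK]
    refine ENNReal.ofReal_le_ofReal ?_
    simpa using h1
  have h3 : ∫⁻ p, ‖s p‖ₑ ^ 2 ∂(spaceTime μ) ≤ ENNReal.ofReal K * ∫⁻ p, ‖G p‖ₑ ^ 2 ∂(spaceTime μ) := by
    rw [lintegral_spaceTime hρ hμ (hs2.1.enorm.pow_const 2),
      lintegral_spaceTime hρ hμ (hG2.1.enorm.pow_const 2),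
      ← lintegral_const_mul' _ _ ENNReal.ofReal_ne_top]
    exact lintegral_mono_ae hle
  rw [← ofReal_integral_sq hs2, ← ofReal_integral_sq hG2, ← ENNReal.ofReal_mul hK,
    ENNReal.ofReal_le_ofReal_iff (mul_nonneg hK (integral_nonneg fun p => sq_nonneg _))] at h3
  simpa using h3

/-! ### The linear interpolation -/

lemma integrable_exp_neg_norm {α : ℝ} (hα : 0 < α) :
    Integrable (fun x : E d => Real.exp (-(α * ‖x‖))) volume := by
  have hfin : (Module.finrank ℝ (E d) : ℝ) < (d : ℝ) + 1 := by
    rw [finrank_euclideanSpace_fin]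
    linarith
  have h1 := integrable_one_add_norm (μ := (volume : Measure (E d))) hfin
  -- From `e^y ≥ y^{d+1}/(d+1)!` at `y = α(1 + ‖x‖)`: the exponential is at most `c (1 +
  -- ‖x‖)^{-(d+1)}`, which is integrable on `ℝ^d`.
  set c := Real.exp α * (d + 1).factorial / α ^ (d + 1) with hc
  refine (h1.const_mul c).mono' (by fun_prop) (Eventually.of_forall fun x => ?_)
  have hpos : 0 < 1 + ‖x‖ := by positivity
  have h2 := Real.pow_div_factorial_le_exp (x := α * (1 + ‖x‖)) (by positivity) (d + 1)
  have hf : (0 : ℝ) < (d + 1).factorial := by exact_mod_cast Nat.factorial_pos _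
  rw [Real.norm_of_nonneg (Real.exp_pos _).le, Real.rpow_neg hpos.le,
    show (d : ℝ) + 1 = ((d + 1 : ℕ) : ℝ) by push_cast; ring, Real.rpow_natCast, Real.exp_neg,
    ← div_eq_mul_inv, le_div_iff₀ (by positivity), inv_mul_le_iff₀ (Real.exp_pos _), hc,
    mul_div_assoc', le_div_iff₀ (by positivity)]
  rw [div_le_iff₀ hf, mul_pow, mul_add, mul_one, Real.exp_add] at h2
  linarith

lemma DriftGrowth.exists_lower_bound {f : E d → ℝ} {α η R₀ : ℝ} (h : DriftGrowth f α η R₀)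
    (hα : 0 < α) (hb : BddBelow (range f)) : ∃ m, ∀ x, α * ‖x‖ - m ≤ f x := by
  obtain ⟨L, hL⟩ := hb
  refine ⟨max 0 (α * R₀ - L), fun x => ?_⟩
  rcases le_total R₀ ‖x‖ with hx | hx
  · linarith [(h x hx).2, le_max_left 0 (α * R₀ - L)]
  · have h1 := hL (mem_range_self x)
    have h2 := mul_le_mul_of_nonneg_left hx hα.le
    linarith [le_max_right 0 (α * R₀ - L)]

lemma potential_ge {f₀ f₁ : E d → ℝ} {α m : ℝ} (h₀ : ∀ x, α * ‖x‖ - m ≤ f₀ x)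
    (h₁ : ∀ x, α * ‖x‖ - m ≤ f₁ x) {t : ℝ} (ht : t ∈ Icc (0 : ℝ) 1) (x : E d) :
    α * ‖x‖ - m ≤ potential f₀ f₁ t x := by
  have e0 := mul_le_mul_of_nonneg_left (h₀ x) (sub_nonneg.2 ht.2)
  have e1 := mul_le_mul_of_nonneg_left (h₁ x) ht.1
  rw [potential]
  linarith

lemma exp_neg_potential_le {f₀ f₁ : E d → ℝ} {α m : ℝ} (h₀ : ∀ x, α * ‖x‖ - m ≤ f₀ x)
    (h₁ : ∀ x, α * ‖x‖ - m ≤ f₁ x) {t : ℝ} (ht : t ∈ Icc (0 : ℝ) 1) (x : E d) :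
    Real.exp (-potential f₀ f₁ t x) ≤ Real.exp m * Real.exp (-(α * ‖x‖)) := by
  rw [← Real.exp_add]
  exact Real.exp_le_exp.2 (by linarith [potential_ge h₀ h₁ ht x])

lemma continuous_potential {f₀ f₁ : E d → ℝ} (hf₀ : Continuous f₀) (hf₁ : Continuous f₁) :
    Continuous fun p : ℝ × E d => potential f₀ f₁ p.1 p.2 := by
  unfold potential
  fun_prop

lemma integrable_exp_neg_potential {f₀ f₁ : E d → ℝ} (hf₀ : Continuous f₀) (hf₁ : Continuous f₁)
    {α m : ℝ} (hα : 0 < α) (h₀ : ∀ x, α * ‖x‖ - m ≤ f₀ x) (h₁ : ∀ x, α * ‖x‖ - m ≤ f₁ x)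
    {t : ℝ} (ht : t ∈ Icc (0 : ℝ) 1) :
    Integrable (fun x => Real.exp (-potential f₀ f₁ t x)) volume := by
  have hc : Continuous fun x => potential f₀ f₁ t x :=
    (continuous_potential hf₀ hf₁).comp (Continuous.prodMk_right t)
  refine ((integrable_exp_neg_norm hα).const_mul (Real.exp m)).mono' (by fun_prop)
    (Eventually.of_forall fun x => ?_)
  rw [Real.norm_of_nonneg (Real.exp_pos _).le]
  exact exp_neg_potential_le h₀ h₁ ht x

/-- Dominated convergence with the bound `e^{m - α‖x‖}`. The case `g = 1` is continuity of `Z_t`;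
bounded continuous `g` give weak continuity. -/
lemma continuousOn_integral_mul_exp {f₀ f₁ : E d → ℝ} (hf₀ : Continuous f₀) (hf₁ : Continuous f₁)
    {α m : ℝ} (hα : 0 < α) (h₀ : ∀ x, α * ‖x‖ - m ≤ f₀ x) (h₁ : ∀ x, α * ‖x‖ - m ≤ f₁ x)
    {g : E d → ℝ} (hg : Continuous g) {b : ℝ} (hb : ∀ x, ‖g x‖ ≤ b) :
    ContinuousOn (fun t => ∫ x, g x * Real.exp (-potential f₀ f₁ t x)) (Icc (0 : ℝ) 1) := by
  have hc := continuous_potential hf₀ hf₁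
  refine continuousOn_of_dominated (bound := fun x => b * (Real.exp m * Real.exp (-(α * ‖x‖))))
    (fun t _ => ?_) (fun t ht => Eventually.of_forall fun x => ?_)
    (((integrable_exp_neg_norm hα).const_mul _).const_mul _)
    (Eventually.of_forall fun x => ?_)
  · have : Continuous fun x => potential f₀ f₁ t x := hc.comp (Continuous.prodMk_right t)
    exact Continuous.aestronglyMeasurable (by fun_prop)
  · rw [norm_mul, Real.norm_of_nonneg (Real.exp_pos _).le]
    exact mul_le_mul (hb x) (exp_neg_potential_le h₀ h₁ ht x) (Real.exp_pos _).le
      ((norm_nonneg _).trans (hb x))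
  · have : Continuous fun t => potential f₀ f₁ t x := hc.comp (Continuous.prodMk_left x)
    exact Continuous.continuousOn (by fun_prop)

lemma continuousOn_partition {f₀ f₁ : E d → ℝ} (hf₀ : Continuous f₀) (hf₁ : Continuous f₁)
    {α m : ℝ} (hα : 0 < α) (h₀ : ∀ x, α * ‖x‖ - m ≤ f₀ x) (h₁ : ∀ x, α * ‖x‖ - m ≤ f₁ x) :
    ContinuousOn (partition f₀ f₁) (Icc (0 : ℝ) 1) := by
  have h := continuousOn_integral_mul_exp hf₀ hf₁ hα h₀ h₁ (g := fun _ => 1) continuous_const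
    (b := 1) (by simp)
  simp only [one_mul] at h
  exact h

lemma measurable_linearCurve_density {f₀ f₁ : E d → ℝ} (hf₀ : Continuous f₀)
    (hf₁ : Continuous f₁) :
    Measurable fun p : ℝ × E d => ENNReal.ofReal
      ((partition f₀ f₁ p.1)⁻¹ * Real.exp (-potential f₀ f₁ p.1 p.2)) := by
  have hc := continuous_potential hf₀ hf₁
  have h1 : Measurable (partition f₀ f₁) := by
    have : StronglyMeasurable fun p : ℝ × E d => Real.exp (-potential f₀ f₁ p.1 p.2) :=
      Continuous.stronglyMeasurable (by fun_prop)
    exact this.integral_prod_right'.measurable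
  have h2 := hc.measurable
  fun_prop

lemma linearCurve_eq_gibbs {f₀ f₁ : E d → ℝ} {t : ℝ} (hZ : 0 < partition f₀ f₁ t) :
    linearCurve f₀ f₁ t = gibbs (normPotential f₀ f₁ t) := by
  rw [linearCurve, gibbs]
  congr 1
  ext x
  rw [normPotential, neg_add, Real.exp_add, Real.exp_neg (Real.log _), Real.exp_log hZ, mul_comm]

lemma isProbabilityMeasure_linearCurve {f₀ f₁ : E d → ℝ} {t : ℝ}
    (hi : Integrable (fun x => Real.exp (-potential f₀ f₁ t x)) volume)
    (hZ : 0 < partition f₀ f₁ t) : IsProbabilityMeasure (linearCurve f₀ f₁ t) := by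
  constructor
  rw [linearCurve, withDensity_apply _ MeasurableSet.univ, Measure.restrict_univ,
    ← ofReal_integral_eq_lintegral_ofReal (hi.const_mul _)
      (Eventually.of_forall fun x => by positivity), integral_const_mul]
  change ENNReal.ofReal ((partition f₀ f₁ t)⁻¹ * partition f₀ f₁ t) = 1
  rw [inv_mul_cancel₀ hZ.ne', ENNReal.ofReal_one]

lemma integral_linearCurve {f₀ f₁ : E d → ℝ} (hf₀ : Continuous f₀) (hf₁ : Continuous f₁) {t : ℝ}
    (hZ : 0 < partition f₀ f₁ t) (g : E d → ℝ) :
    ∫ x, g x ∂(linearCurve f₀ f₁ t)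
      = (partition f₀ f₁ t)⁻¹ * ∫ x, g x * Real.exp (-potential f₀ f₁ t x) := by
  have hc : Continuous fun x => potential f₀ f₁ t x :=
    (continuous_potential hf₀ hf₁).comp (Continuous.prodMk_right t)
  have hm : Measurable fun x => ENNReal.ofReal
      ((partition f₀ f₁ t)⁻¹ * Real.exp (-potential f₀ f₁ t x)) := by
    have := hc.measurable
    fun_prop
  rw [linearCurve, integral_withDensity_eq_integral_toReal_smul hm
    (Eventually.of_forall fun _ => ENNReal.ofReal_lt_top), ← integral_const_mul]
  refine integral_congr_ae (Eventually.of_forall fun x => ?_)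
  simp only [smul_eq_mul]
  rw [ENNReal.toReal_ofReal (by positivity)]
  ring

lemma isWeaklyContinuousCurve_linearCurve {f₀ f₁ : E d → ℝ} (hf₀ : Continuous f₀)
    (hf₁ : Continuous f₁) {α m : ℝ} (hα : 0 < α) (h₀ : ∀ x, α * ‖x‖ - m ≤ f₀ x)
    (h₁ : ∀ x, α * ‖x‖ - m ≤ f₁ x) (hZ : ∀ t ∈ Icc (0 : ℝ) 1, 0 < partition f₀ f₁ t) :
    IsWeaklyContinuousCurve (linearCurve f₀ f₁) := by
  let ν : Icc (0 : ℝ) 1 → ProbabilityMeasure (E d) := fun t => ⟨linearCurve f₀ f₁ t,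
    isProbabilityMeasure_linearCurve (integrable_exp_neg_potential hf₀ hf₁ hα h₀ h₁ t.2)
      (hZ t t.2)⟩
  refine ⟨fun t _ => withDensity_absolutelyContinuous _ _, ν, fun t => rfl, ?_⟩
  refine ProbabilityMeasure.continuous_iff_forall_continuous_integral.2 fun g => ?_
  have h : ContinuousOn (fun t => (partition f₀ f₁ t)⁻¹ *
      ∫ x, g x * Real.exp (-potential f₀ f₁ t x)) (Icc (0 : ℝ) 1) :=
    ((continuousOn_partition hf₀ hf₁ hα h₀ h₁).inv₀ fun t ht => (hZ t ht).ne').mul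
      (continuousOn_integral_mul_exp hf₀ hf₁ hα h₀ h₁ g.continuous fun x => g.norm_coe_le_norm x)
  refine (continuousOn_iff_continuous_domRestrict.1 h).congr fun t => ?_
  exact (integral_linearCurve hf₀ hf₁ (hZ t t.2) g).symm

lemma contDiff_normPotential {f₀ f₁ : E d → ℝ} (hf₀ : ContDiff ℝ 1 f₀) (hf₁ : ContDiff ℝ 1 f₁)
    (t : ℝ) : ContDiff ℝ 1 (normPotential f₀ f₁ t) := by
  change ContDiff ℝ 1 fun x => (1 - t) * f₀ x + t * f₁ x + Real.log (partition f₀ f₁ t)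
  fun_prop

lemma gradient_normPotential {f₀ f₁ : E d → ℝ} (hf₀ : ContDiff ℝ 1 f₀) (hf₁ : ContDiff ℝ 1 f₁)
    (t : ℝ) (x : E d) :
    gradient (normPotential f₀ f₁ t) x = (1 - t) • gradient f₀ x + t • gradient f₁ x := by
  have d0 := (hf₀.differentiable (by simp) x).hasFDerivAt
  have d1 := (hf₁.differentiable (by simp) x).hasFDerivAt
  have h : HasFDerivAt (normPotential f₀ f₁ t) _ x :=
    ((d0.const_mul (1 - t)).add (d1.const_mul t)).add_const (Real.log (partition f₀ f₁ t))
  simp [gradient, h.fderiv]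

lemma bddAbove_potentialValues {f₀ f₁ : E d → ℝ} (hf₀ : Continuous f₀) (hf₁ : Continuous f₁)
    (hc : ContinuousOn (partition f₀ f₁) (Icc (0 : ℝ) 1))
    (hZ : ∀ t ∈ Icc (0 : ℝ) 1, 0 < partition f₀ f₁ t) (R : ℝ) :
    BddAbove (potentialValues f₀ f₁ R) := by
  refine (isCompact_Icc.prod (isCompact_closedBall (0 : E d) R)).bddAbove_image
    (ContinuousOn.abs ((continuous_potential hf₀ hf₁).continuousOn.add ?_))
  exact (hc.comp continuousOn_fst fun p hp => hp.1).log fun p hp => (hZ p.1 hp.1).ne'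

lemma bddAbove_gradientValues {f₀ f₁ : E d → ℝ} (hf₀ : ContDiff ℝ 1 f₀) (hf₁ : ContDiff ℝ 1 f₁)
    (R : ℝ) : BddAbove (gradientValues f₀ f₁ R) := by
  refine (isCompact_Icc.prod (isCompact_closedBall (0 : E d) R)).bddAbove_image ?_
  simp only [gradient_normPotential hf₀ hf₁]
  have h0 := continuous_gradient hf₀
  have h1 := continuous_gradient hf₁
  exact Continuous.continuousOn (by fun_prop)

/-! ### The Poincaré constant in the stated form. -/

lemma poincareConst_pos {η R g M : ℝ} (hη : 0 < η) (hR : 0 < R) (hg : 0 ≤ g) :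
    0 < poincareConst d η R g M := by
  unfold poincareConst
  positivity

/-- Here `64/η²` is `16 · 4/η²`. The surplus 16 on the leading 1 is absorbed by `16/R²` inside the
bracket, because `(16/R²) R² e^{2M} ≥ 16`; the factor `d` on the right is at least 1. -/
lemma poincareConst_le (hd : 0 < d) {η R g M : ℝ} (hη : 0 < η) (hR : 0 < R) (hg : 0 ≤ g)
    (hM : 0 ≤ M) :
    poincareConst d η R g M ≤ 4 * d / η ^ 2 *
      (1 + ((16 / R ^ 2 + 2 ^ (d + 1) * η ^ 2 + 1) + (2 ^ (d + 1) * (2 * |η|) + 1) * g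
        + (2 ^ (d + 1) * (2 * |η| * d / |R|) + 1)) * 1 * R ^ 2 * Real.exp (2 * M)) := by
  have hd1 : (1 : ℝ) ≤ d := by exact_mod_cast hd
  have he : 1 ≤ Real.exp (2 * M) := Real.one_le_exp (by positivity)
  rw [abs_of_pos hη, abs_of_pos hR, poincareConst]
  have h1 : 64 / η ^ 2 = 4 / η ^ 2 * 16 := by ring
  have h2 : 4 * d / η ^ 2 = 4 / η ^ 2 * (d : ℝ) := by ring
  rw [h1, h2, mul_assoc (4 / η ^ 2), mul_assoc (4 / η ^ 2)]
  refine mul_le_mul_of_nonneg_left ?_ (by positivity : 0 ≤ 4 / η ^ 2)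
  set e := Real.exp (2 * M)
  set p : ℝ := 2 ^ (d + 1)
  have hp : 0 < p := by positivity
  have h3 : 16 * (1 + (η ^ 2 / 64 + (η / 8 * g + η / 8 * d / R + (η / 8) ^ 2)) * (p * R ^ 2 * e))
      ≤ 1 + (16 / R ^ 2 + p * η ^ 2 + 1 + (p * (2 * η) + 1) * g + (p * (2 * η * d / R) + 1))
        * 1 * R ^ 2 * e := by
    have e1 : 1 + (16 / R ^ 2 + p * η ^ 2 + 1 + (p * (2 * η) + 1) * g + (p * (2 * η * d / R) + 1))
        * 1 * R ^ 2 * e = 1 + 16 * e + (2 + g) * R ^ 2 * e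
          + (η ^ 2 + 2 * η * g + 2 * η * d / R) * (p * R ^ 2 * e) := by
      field_simp
      ring
    have e2 : 16 * (1 + (η ^ 2 / 64 + (η / 8 * g + η / 8 * d / R + (η / 8) ^ 2)) * (p * R ^ 2 * e))
        = 16 + (η ^ 2 / 2 + 2 * η * g + 2 * η * d / R) * (p * R ^ 2 * e) := by ring
    rw [e1, e2]
    have h4 : 0 ≤ (2 + g) * R ^ 2 * e := by positivity
    have h5 : (η ^ 2 / 2 + 2 * η * g + 2 * η * d / R) * (p * R ^ 2 * e)
        ≤ (η ^ 2 + 2 * η * g + 2 * η * d / R) * (p * R ^ 2 * e) := by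
      gcongr
      linarith [sq_nonneg η]
    linarith
  refine h3.trans (le_mul_of_one_le_left ?_ hd1)
  positivity

end PPI

end

/-! ### Assembly of the theorem. -/

theorem mainTheorem3 :
    ∃ (D : ℝ) (C₁ C₂ C₃ : ℕ → ℝ → ℝ → ℝ), 0 < D ∧
      (∀ d η R, 0 < C₁ d η R ∧ 0 < C₂ d η R ∧ 0 < C₃ d η R) ∧
      ∀ (d : ℕ), 0 < d → ∀ (f₀ f₁ : PPI.E d → ℝ) (α η R₀ : ℝ),
        ContDiff ℝ 2 f₀ → ContDiff ℝ 2 f₁ →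
        BddBelow (range f₀) → BddBelow (range f₁) →
        0 < α → 0 < η → 0 < R₀ →
        PPI.DriftGrowth f₀ α η R₀ → PPI.DriftGrowth f₁ α η R₀ →
        ∀ R : ℝ, R = max (2 * d / η) R₀ →
        -- the curve and its space-time measure are well defined
        (∀ t ∈ Icc (0 : ℝ) 1,
          Integrable (fun x => Real.exp (- PPI.potential f₀ f₁ t x)) volume ∧
            0 < PPI.partition f₀ f₁ t) ∧
        PPI.IsWeaklyContinuousCurve (PPI.linearCurve f₀ f₁) ∧
        IsProbabilityMeasure (PPI.spaceTime (PPI.linearCurve f₀ f₁)) ∧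
        PPI.IsDisintegration (PPI.linearCurve f₀ f₁) (PPI.spaceTime (PPI.linearCurve f₀ f₁)) ∧
        -- the suprema entering the constant are finite
        BddAbove (PPI.potentialValues f₀ f₁ R) ∧ BddAbove (PPI.gradientValues f₀ f₁ R) ∧
        -- Poincare inequalities with one constant, uniform in time
        ∃ C : ℝ, 0 < C ∧
          C ≤ 4 * d / η ^ 2 *
            (1 + (C₁ d η R + C₂ d η R * sSup (PPI.gradientValues f₀ f₁ R) + C₃ d η R) *
              D * R ^ 2 * Real.exp (2 * sSup (PPI.potentialValues f₀ f₁ R))) ∧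
          (∀ t ∈ Icc (0 : ℝ) 1, PPI.PoincareWith (PPI.linearCurve f₀ f₁ t) C) ∧
          PPI.PartialPoincareWith (PPI.linearCurve f₀ f₁) C := by
  -- The absolute values and the added 1's make the three constants positive for all real arguments,
  -- including meaningless ones.
  refine ⟨1, fun d η R => 16 / R ^ 2 + 2 ^ (d + 1) * η ^ 2 + 1,
    fun d η _ => 2 ^ (d + 1) * (2 * |η|) + 1,
    fun d η R => 2 ^ (d + 1) * (2 * |η| * d / |R|) + 1, one_pos,
    fun d η R => ⟨by positivity, by positivity, by positivity⟩, ?_⟩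
  intro d hd f₀ f₁ α η R₀ hf₀ hf₁ hb₀ hb₁ hα hη hR₀ hg₀ hg₁ R hR
  have hRpos : 0 < R := hR ▸ lt_max_of_lt_right hR₀
  have hdR : 2 * d / η ≤ R := hR ▸ le_max_left _ _
  have hR₀R : R₀ ≤ R := hR ▸ le_max_right _ _
  obtain ⟨m₀, hm₀⟩ := hg₀.exists_lower_bound hα hb₀
  obtain ⟨m₁, hm₁⟩ := hg₁.exists_lower_bound hα hb₁
  have h₀ : ∀ x, α * ‖x‖ - max m₀ m₁ ≤ f₀ x := fun x => by
    linarith [hm₀ x, le_max_left m₀ m₁]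
  have h₁ : ∀ x, α * ‖x‖ - max m₀ m₁ ≤ f₁ x := fun x => by
    linarith [hm₁ x, le_max_right m₀ m₁]
  have hc₀ : ContDiff ℝ 1 f₀ := hf₀.of_le (by norm_num)
  have hc₁ : ContDiff ℝ 1 f₁ := hf₁.of_le (by norm_num)
  have hint : ∀ t ∈ Icc (0 : ℝ) 1,
      Integrable (fun x => Real.exp (- PPI.potential f₀ f₁ t x)) volume := fun t ht =>
    PPI.integrable_exp_neg_potential hf₀.continuous hf₁.continuous hα h₀ h₁ ht
  have hZ : ∀ t ∈ Icc (0 : ℝ) 1, 0 < PPI.partition f₀ f₁ t := fun t ht =>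
    integral_exp_pos (hint t ht)
  have hprob : ∀ t ∈ Icc (0 : ℝ) 1, IsProbabilityMeasure (PPI.linearCurve f₀ f₁ t) := fun t ht =>
    PPI.isProbabilityMeasure_linearCurve (hint t ht) (hZ t ht)
  have hρ := PPI.measurable_linearCurve_density hf₀.continuous hf₁.continuous
  have hdis : PPI.IsDisintegration (PPI.linearCurve f₀ f₁)
      (PPI.spaceTime (PPI.linearCurve f₀ f₁)) :=
    PPI.isDisintegration_spaceTime hρ fun t => rfl
  have hbV := PPI.bddAbove_potentialValues hf₀.continuous hf₁.continuous
    (PPI.continuousOn_partition hf₀.continuous hf₁.continuous hα h₀ h₁) hZ R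
  have hbG := PPI.bddAbove_gradientValues hc₀ hc₁ R
  have hg0 : 0 ≤ sSup (PPI.gradientValues f₀ f₁ R) :=
    Real.sSup_nonneg (by rintro _ ⟨p, -, rfl⟩; exact norm_nonneg _)
  have hM0 : 0 ≤ sSup (PPI.potentialValues f₀ f₁ R) :=
    Real.sSup_nonneg (by rintro _ ⟨p, -, rfl⟩; exact abs_nonneg _)
  have hpoincare : ∀ t ∈ Icc (0 : ℝ) 1, PPI.PoincareWith (PPI.linearCurve f₀ f₁ t)
      (PPI.poincareConst d η R (sSup (PPI.gradientValues f₀ f₁ R))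
        (sSup (PPI.potentialValues f₀ f₁ R))) := by
    intro t ht
    have hp := hprob t ht
    rw [PPI.linearCurve_eq_gibbs (hZ t ht)] at hp ⊢
    refine PPI.poincareWith_gibbs hd (PPI.contDiff_normPotential hc₀ hc₁ t) hη hRpos hdR
      (fun x hx => ?_) hg0 (fun x hx => le_csSup hbG ⟨(t, x), ⟨ht, hx⟩, rfl⟩)
      (fun x hx => le_csSup hbV ⟨(t, x), ⟨ht, hx⟩, rfl⟩)
    -- The drift of the interpolation is the convex combination of the two drifts.
    rw [PPI.gradient_normPotential hc₀ hc₁, inner_add_right, inner_smul_right, inner_smul_right]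
    have e0 := mul_le_mul_of_nonneg_left (hg₀ x (hR₀R.trans hx)).1 (sub_nonneg.2 ht.2)
    have e1 := mul_le_mul_of_nonneg_left (hg₁ x (hR₀R.trans hx)).1 ht.1
    linarith
  have hCpos := PPI.poincareConst_pos (d := d) (M := sSup (PPI.potentialValues f₀ f₁ R))
    hη hRpos hg0
  refine ⟨fun t ht => ⟨hint t ht, hZ t ht⟩,
    PPI.isWeaklyContinuousCurve_linearCurve hf₀.continuous hf₁.continuous hα h₀ h₁ hZ, ⟨?_⟩, hdis,
    hbV, hbG, _, hCpos, PPI.poincareConst_le hd hη hRpos hg0 hM0, hpoincare,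
    PPI.partialPoincareWith_of_forall hρ (fun t => rfl) hCpos.le hpoincare⟩
  -- Total mass: the disintegration formula for the constant 1, each `ρ_t` being a probability
  -- measure.
  have h := hdis (fun _ => 1) measurable_const
  rw [lintegral_one] at h
  rw [h, setLIntegral_congr_fun (g := fun _ => 1) measurableSet_Icc fun t ht => ?_]
  · simp
  · have := hprob t ht
    simp
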